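/- Let $(R,P)$ be a commutative Noetherian local ring, let $I,J\subseteq R$ be ideals, let $M,N$ be finitely generated $R$-modules and let $i\ge 0$. Assume that both $I+\operatorname{ann}_R M+\operatorname{ann}_R N$ and $J+\operatorname{ann}_R M+\operatorname{ann}_R N$ are $P$-primary. Let $\ell_M(I)$ denote the analytic spread of $I$ on $M$, that is, the Krull dimension of the module $\bigoplus_{n\ge 0} I^nM/PI^nM$ over the Rees algebra $\bigoplus_{n\ge 0} I^n$, and define $\ell_N(J)$ likewise. Let $\lambda$ denote length, and suppose that there is a polynomial $p\in\mathbb{Q}[x,y]$ with $$\lambda\bigl(\operatorname{Tor}_i^R(M/I^nM,\,N/J^mN)\bigr)=p(n,m)\quad\text{for all sufficiently large } n \text{ and } m.$$ Then the total degree of $p$ satisfies $$\deg p\ \le\ \max\{\ell_M(I),1\}+\max\{\ell_N(J),1\}-2 .$$ In particular, $\deg p\le \ell_M(I)+\ell_N(J)-2$ whenever $\ell_M(I)\ge 1$ and $\ell_N(J)\ge 1$. -/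

import Mathlib

open CategoryTheory

universe u

/-- `Tor_i^R(A, B)`, for modules over a commutative ring `R`. -/
noncomputable abbrev torModule (R : Type u) [CommRing R] (i : ℕ)
    (A B : Type u) [AddCommGroup A] [Module R A] [AddCommGroup B] [Module R B] :
    ModuleCat.{u} R :=
  ((Tor (ModuleCat.{u} R) i).obj (ModuleCat.of R A)).obj (ModuleCat.of R B)

/-- The quotient `M / I ^ n M`. -/
abbrev powQuotient {R : Type u} [CommRing R] (I : Ideal R) (n : ℕ)
    (M : Type u) [AddCommGroup M] [Module R M] : Type u :=
  M ⧸ (I ^ n • ⊤ : Submodule R M)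

/-- An ideal `Q` is `P`-primary: it is primary, with radical `P`. -/
def IsPrimaryTo {R : Type u} [CommRing R] (Q P : Ideal R) : Prop :=
  Q.IsPrimary ∧ Q.radical = P

/-- The Rees module `⨁ₙ I ^ n M`, as a module over the Rees algebra `⨁ₙ I ^ n`
(realized inside the polynomial module `M[X]`: the coefficient at `X ^ n` lies in `I ^ n M`). -/
noncomputable abbrev reesModule {R : Type u} [CommRing R] (I : Ideal R)
    (M : Type u) [AddCommGroup M] [Module R M] :
    Submodule (reesAlgebra I) (PolynomialModule R M) :=
  (I.stableFiltration (⊤ : Submodule R M)).submodule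

/-- The Krull dimension of the `A`-module `X / aX`. -/
noncomputable def quotientDim (A X : Type u) [CommRing A] [AddCommGroup X] [Module A X]
    (a : Ideal A) : WithBot ℕ∞ :=
  Module.supportDim A (X ⧸ (a • ⊤ : Submodule A X))

/-- The analytic spread `ℓ_M(I)` of `I` on `M`: the Krull dimension, over the Rees algebra of `I`,
of the fiber module `⨁ₙ I ^ n M / P I ^ n M` (the Rees module of `M` modulo `P` times it), where `P`
is the maximal ideal of `R`. -/
noncomputable def analyticSpread {R : Type u} [CommRing R] [IsLocalRing R] (I : Ideal R)
    (M : Type u) [AddCommGroup M] [Module R M] : WithBot ℕ∞ :=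
  quotientDim (reesAlgebra I) (reesModule I M)
    ((IsLocalRing.maximalIdeal R).map (algebraMap R (reesAlgebra I)))

/-- The lengths of the modules `T n m` are finite and equal to `p(n, m)`, for all large `n`, `m`. -/
def LengthEventuallyEq {R : Type u} [CommRing R] (T : ℕ → ℕ → ModuleCat.{u} R)
    (p : MvPolynomial (Fin 2) ℚ) : Prop :=
  ∃ k : ℕ, ∀ n m : ℕ, k ≤ n → k ≤ m →
    ∃ l : ℕ, Module.length R (T n m) = (l : ℕ∞) ∧ (l : ℚ) = MvPolynomial.eval ![(n : ℚ), (m : ℚ)] p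

/-! Since `p.totalDegree` is at most the sum of the degrees in each variable, it suffices to show
that the degree in `n` is less than `d = max{ℓ_M(I), 1}`, and symmetrically in `m`. The leading
coefficient in `n` is a polynomial in `m`, so one large `m` may be fixed at a time, with constants
depending on it. Put `B = N/J^mN`; then `ann M + ann B` contains a power `P^k`, which kills
`Tor_i(M, B)` and every `Tor_i(M/I^nM, B)`.

For `i > 0` these modules are the kernels of `K ⊗ - → F ⊗ -` for one syzygy `K ⊆ F` of `B`. With `G
= F ⊗ M` and `L` the image of `K ⊗ M`, the length at `M/I^nM` is at most the constant length of
`Tor_i(M, B)` plus that of `(L ∩ I^nG)/I^nL`. By Artin–Rees, `L ∩ I^nG = I^jU` with `j = n - n₀` and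
`U` fixed, and `P^k` carries it into `I^nL`; so the second length is at most that of `I^jU/P^kI^jU`
(`exists_sum_length_ker_rTensor_le`).

These quotients are filtered by fibers `I^jU'/PI^jU'`, on which the Rees algebra acts through its
quotient by `fiberIdeal`, a finitely generated algebra over the residue field of dimension `ℓ_M(I)`.
Noether normalization bounds its growth (`exists_card_le_of_ringKrullDim_le`). What results is a
bound `C(m+1)^d` on partial sums over `j < m`, and a nonnegative polynomial with such partial sums
has degree below `d` (`natDegree_lt_of_sum_le`). -/

/-! ### Kernels of tensored maps and the balancing of `Tor₁`. -/

section TensorKernels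

open TensorProduct

/-- In a commutative square `u ∘ a = v ∘ b` of modules with `u` and `v` injective, the kernels of the
maps induced on the cokernels of `a` and of `b` by `u` and `v` agree. -/
theorem nonempty_ker_equiv_ker_of_square {R W X₁ X₂ G C₁ C₂ D₁ D₂ : Type*} [CommRing R]
    [AddCommGroup W] [Module R W] [AddCommGroup X₁] [Module R X₁] [AddCommGroup X₂] [Module R X₂]
    [AddCommGroup G] [Module R G] [AddCommGroup C₁] [Module R C₁] [AddCommGroup C₂] [Module R C₂]
    [AddCommGroup D₁] [Module R D₁] [AddCommGroup D₂] [Module R D₂]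
    (a : W →ₗ[R] X₁) (b : W →ₗ[R] X₂) (u : X₁ →ₗ[R] G) (v : X₂ →ₗ[R] G)
    (hu : Function.Injective u) (hv : Function.Injective v) (hsq : ∀ w, u (a w) = v (b w))
    (p₁ : X₁ →ₗ[R] C₁) (hp₁ : Function.Surjective p₁) (hap₁ : Function.Exact a p₁)
    (p₂ : X₂ →ₗ[R] C₂) (hp₂ : Function.Surjective p₂) (hbp₂ : Function.Exact b p₂)
    (q₁ : G →ₗ[R] D₁) (hq₁ : Function.Exact v q₁) (q₂ : G →ₗ[R] D₂) (hq₂ : Function.Exact u q₂)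
    (φ₁ : C₁ →ₗ[R] D₁) (h₁ : ∀ x, φ₁ (p₁ x) = q₁ (u x))
    (φ₂ : C₂ →ₗ[R] D₂) (h₂ : ∀ x, φ₂ (p₂ x) = q₂ (v x)) :
    Nonempty (LinearMap.ker φ₁ ≃ₗ[R] LinearMap.ker φ₂) := by
  -- The fiber product of `X₁` and `X₂` over `G` maps onto both kernels, and in each case the kernel
  -- of that map is the image of `W`.
  let E := LinearMap.eqLocus (u ∘ₗ LinearMap.fst R X₁ X₂) (v ∘ₗ LinearMap.snd R X₁ X₂)
  have hE : ∀ z : E, u z.1.1 = v z.1.2 := fun z => z.2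
  let π₁ : E →ₗ[R] LinearMap.ker φ₁ :=
    (p₁ ∘ₗ LinearMap.fst R X₁ X₂ ∘ₗ E.subtype).codRestrict _ fun z => by
      simp only [LinearMap.mem_ker, LinearMap.comp_apply, LinearMap.fst_apply,
        Submodule.subtype_apply, h₁, hE]
      exact hq₁.apply_apply_eq_zero _
  let π₂ : E →ₗ[R] LinearMap.ker φ₂ :=
    (p₂ ∘ₗ LinearMap.snd R X₁ X₂ ∘ₗ E.subtype).codRestrict _ fun z => by
      simp only [LinearMap.mem_ker, LinearMap.comp_apply, LinearMap.snd_apply,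
        Submodule.subtype_apply, h₂, ← hE]
      exact hq₂.apply_apply_eq_zero _
  have s₁ : Function.Surjective π₁ := by
    rintro ⟨c, hc⟩
    obtain ⟨x, rfl⟩ := hp₁ c
    rw [LinearMap.mem_ker, h₁] at hc
    obtain ⟨y, hy⟩ := (hq₁ _).1 hc
    exact ⟨⟨(x, y), hy.symm⟩, rfl⟩
  have s₂ : Function.Surjective π₂ := by
    rintro ⟨c, hc⟩
    obtain ⟨y, rfl⟩ := hp₂ c
    rw [LinearMap.mem_ker, h₂] at hc
    obtain ⟨x, hx⟩ := (hq₂ _).1 hc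
    exact ⟨⟨(x, y), hx⟩, rfl⟩
  have hk : LinearMap.ker π₁ = LinearMap.ker π₂ := by
    ext z
    have e₁ : z ∈ LinearMap.ker π₁ ↔ p₁ z.1.1 = 0 := by
      rw [LinearMap.mem_ker, Subtype.ext_iff]; rfl
    have e₂ : z ∈ LinearMap.ker π₂ ↔ p₂ z.1.2 = 0 := by
      rw [LinearMap.mem_ker, Subtype.ext_iff]; rfl
    rw [e₁, e₂, hap₁, hbp₂]
    constructor
    · rintro ⟨w, hw⟩
      exact ⟨w, hv (by rw [← hsq, hw, hE])⟩
    · rintro ⟨w, hw⟩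
      exact ⟨w, hu (by rw [hsq, hw, hE])⟩
  exact ⟨(π₁.quotKerEquivOfSurjective s₁).symm.trans
    ((Submodule.quotEquivOfEq _ _ hk).trans (π₂.quotKerEquivOfSurjective s₂))⟩

variable {R : Type u} [CommRing R]

/-- `Tor₁` is balanced: for `0 → K → F → A → 0` and `0 → Z → Q → C → 0` exact with `F`, `Q` flat,
the kernels of `K ⊗ C → F ⊗ C` and of `A ⊗ Z → A ⊗ Q` agree. -/
theorem nonempty_ker_rTensor_equiv_ker_lTensor {K F A Z Q C : Type*}
    [AddCommGroup K] [Module R K] [AddCommGroup F] [Module R F] [AddCommGroup A] [Module R A]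
    [AddCommGroup Z] [Module R Z] [AddCommGroup Q] [Module R Q] [AddCommGroup C] [Module R C]
    [Module.Flat R F] [Module.Flat R Q]
    (f : K →ₗ[R] F) (hf : Function.Injective f) (p : F →ₗ[R] A) (hp : Function.Surjective p)
    (hfp : Function.Exact f p)
    (g : Z →ₗ[R] Q) (hg : Function.Injective g) (q : Q →ₗ[R] C) (hq : Function.Surjective q)
    (hgq : Function.Exact g q) :
    Nonempty (LinearMap.ker (f.rTensor C) ≃ₗ[R] LinearMap.ker (g.lTensor A)) :=
  nonempty_ker_equiv_ker_of_square (g.lTensor K) (f.rTensor Z) (f.rTensor Q) (g.lTensor F)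
    (Module.Flat.rTensor_preserves_injective_linearMap f hf)
    (Module.Flat.lTensor_preserves_injective_linearMap g hg)
    (fun w => by rw [← LinearMap.comp_apply, ← LinearMap.comp_apply,
      LinearMap.rTensor_comp_lTensor, LinearMap.lTensor_comp_rTensor])
    (q.lTensor K) (LinearMap.lTensor_surjective _ hq) (lTensor_exact K hgq hq)
    (p.rTensor Z) (LinearMap.rTensor_surjective _ hp) (rTensor_exact Z hfp hp)
    (q.lTensor F) (lTensor_exact F hgq hq) (p.rTensor Q) (rTensor_exact Q hfp hp)
    (f.rTensor C) (fun w => by rw [← LinearMap.comp_apply, ← LinearMap.comp_apply,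
      LinearMap.rTensor_comp_lTensor, LinearMap.lTensor_comp_rTensor])
    (g.lTensor A) (fun w => by rw [← LinearMap.comp_apply, ← LinearMap.comp_apply,
      LinearMap.rTensor_comp_lTensor, LinearMap.lTensor_comp_rTensor])

/-- The homology of `A ⊗ Q₂ → A ⊗ Q₁ → A ⊗ Q₀`, for `Q₂ → Q₁ → Q₀` exact, is the kernel of
`A ⊗ im (Q₁ → Q₀) → A ⊗ Q₀`. -/
theorem nonempty_homology_equiv_ker_lTensor (A : Type*) {Q₂ Q₁ Q₀ : Type*}
    [AddCommGroup A] [Module R A] [AddCommGroup Q₂] [Module R Q₂] [AddCommGroup Q₁] [Module R Q₁]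
    [AddCommGroup Q₀] [Module R Q₀] (d₁ : Q₂ →ₗ[R] Q₁) (d₀ : Q₁ →ₗ[R] Q₀)
    (h : Function.Exact d₁ d₀) (c : (A ⊗[R] Q₂) →ₗ[R] LinearMap.ker (d₀.lTensor A))
    (hc : ∀ x, (c x : A ⊗[R] Q₁) = d₁.lTensor A x) :
    Nonempty ((LinearMap.ker (d₀.lTensor A) ⧸ LinearMap.range c) ≃ₗ[R]
      LinearMap.ker ((LinearMap.range d₀).subtype.lTensor A)) := by
  have hcomp : (LinearMap.range d₀).subtype.lTensor A ∘ₗ d₀.rangeRestrict.lTensor A =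
      d₀.lTensor A := by
    rw [← LinearMap.lTensor_comp]; rfl
  have hex : Function.Exact (d₁.lTensor A) (d₀.rangeRestrict.lTensor A) := by
    refine lTensor_exact A ?_ d₀.surjective_rangeRestrict
    intro x
    rw [← h x, Subtype.ext_iff]; rfl
  have hsurj := LinearMap.lTensor_surjective A d₀.surjective_rangeRestrict
  let π : LinearMap.ker (d₀.lTensor A) →ₗ[R]
      LinearMap.ker ((LinearMap.range d₀).subtype.lTensor A) :=
    ((d₀.rangeRestrict.lTensor A) ∘ₗ Submodule.subtype _).codRestrict _ fun z => by
      rw [LinearMap.mem_ker, LinearMap.comp_apply, ← LinearMap.comp_apply, hcomp]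
      exact z.2
  have hπ : Function.Surjective π := by
    rintro ⟨y, hy⟩
    obtain ⟨x, rfl⟩ := hsurj y
    refine ⟨⟨x, ?_⟩, rfl⟩
    rw [LinearMap.mem_ker, ← hcomp]
    exact hy
  have hk : LinearMap.range c = LinearMap.ker π := by
    ext z
    have e : z ∈ LinearMap.ker π ↔ d₀.rangeRestrict.lTensor A z.1 = 0 := by
      rw [LinearMap.mem_ker, Subtype.ext_iff]; rfl
    rw [e, hex z.1]
    constructor
    · rintro ⟨x, rfl⟩
      exact ⟨x, (hc x).symm⟩
    · rintro ⟨x, hx⟩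
      exact ⟨x, Subtype.ext ((hc x).trans hx)⟩
  exact ⟨(Submodule.quotEquivOfEq _ _ hk).trans (π.quotKerEquivOfSurjective hπ)⟩

end TensorKernels

/-! ### `Tor` as the kernel of a tensored syzygy inclusion. -/

section Tor

variable {R : Type u} [CommRing R]

/-- Every module has a flat resolution that computes `Tor` as kernels of `A ⊗ Zᵢ → A ⊗ Qᵢ`. -/
theorem exists_flat_resolution (B : Type u) [AddCommGroup B] [Module R B] :
    ∃ (Q : ℕ → ModuleCat.{u} R) (d : ∀ i, Q (i + 1) →ₗ[R] Q i) (π : Q 0 →ₗ[R] B),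
      (∀ i, Module.Flat R (Q i)) ∧ Function.Surjective π ∧ Function.Exact (d 0) π ∧
      (∀ i, Function.Exact (d (i + 1)) (d i)) ∧
      ∀ (A : Type u) [AddCommGroup A] [Module R A] (i : ℕ),
        Nonempty (torModule R (i + 1) A B ≃ₗ[R]
          LinearMap.ker ((LinearMap.range (d i)).subtype.lTensor A)) := by
  obtain ⟨P⟩ := (inferInstance : HasProjectiveResolution (ModuleCat.of R B)).out
  have hex : ∀ i, Function.Exact (P.complex.d (i + 2) (i + 1)).hom
      (P.complex.d (i + 1) i).hom := fun i =>
    (ShortComplex.ShortExact.moduleCat_exact_iff_function_exact _).1 (P.exact_succ i)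
  refine ⟨fun i => P.complex.X i, fun i => (P.complex.d (i + 1) i).hom, (P.π.f 0).hom,
    fun i => ?_, ?_, ?_, hex, ?_⟩
  · have : Module.Projective R (P.complex.X i) :=
      (IsProjective.iff_projective (P.complex.X i)).2 (P.projective i)
    infer_instance
  · exact (ModuleCat.epi_iff_surjective _).1 inferInstance
  · exact (ShortComplex.ShortExact.moduleCat_exact_iff_function_exact _).1 P.exact₀
  · intro A _ _ i
    let T := (MonoidalCategory.tensoringLeft (ModuleCat.{u} R)).obj (ModuleCat.of R A)
    let S := ((T.mapHomologicalComplex (ComplexShape.down ℕ)).obj P.complex).sc' (i + 2) (i + 1) i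
    let e : torModule R (i + 1) A B ≅ S.moduleCatLeftHomologyData.H :=
      P.isoLeftDerivedObj T (i + 1) ≪≫
        ((T.mapHomologicalComplex (ComplexShape.down ℕ)).obj P.complex).homologyIsoSc'
          (i + 2) (i + 1) i (by simp) (by simp) ≪≫ S.moduleCatHomologyIso
    obtain ⟨e'⟩ := nonempty_homology_equiv_ker_lTensor A _ _ (hex i) S.moduleCatToCycles
      (fun x => rfl)
    exact ⟨e.toLinearEquiv.trans e'⟩

theorem nonempty_torModule_zero_equiv (A B : Type u) [AddCommGroup A] [Module R A]
    [AddCommGroup B] [Module R B] :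
    Nonempty (torModule R 0 A B ≃ₗ[R] TensorProduct R A B) :=
  ⟨(((((MonoidalCategory.tensoringLeft (ModuleCat.{u} R)).obj
    (ModuleCat.of R A)).leftDerivedZeroIsoSelf).app (ModuleCat.of R B) :
      torModule R 0 A B ≅ ModuleCat.of R (TensorProduct R A B))).toLinearEquiv⟩

theorem nonempty_torModule_one_equiv_ker_rTensor {K F A : Type u} [AddCommGroup K] [Module R K]
    [AddCommGroup F] [Module R F] [AddCommGroup A] [Module R A] [Module.Flat R F]
    (f : K →ₗ[R] F) (hf : Function.Injective f) (p : F →ₗ[R] A) (hp : Function.Surjective p)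
    (hfp : Function.Exact f p) (B : Type u) [AddCommGroup B] [Module R B] :
    Nonempty (torModule R 1 A B ≃ₗ[R] LinearMap.ker (f.rTensor B)) := by
  obtain ⟨Q, d, π, hQ, hπ, hdπ, -, hT⟩ := exists_flat_resolution (R := R) B
  have := hQ 0
  obtain ⟨e⟩ := hT A 0
  obtain ⟨e'⟩ := nonempty_ker_rTensor_equiv_ker_lTensor f hf p hp hfp
    (LinearMap.range (d 0)).subtype (Submodule.injective_subtype _) π hπ
    (by rw [LinearMap.exact_iff, Submodule.range_subtype]; exact hdπ.linearMap_ker_eq)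
  exact ⟨e.trans e'.symm⟩

/-- Let `Z` be the image of `d i`. Balancing turns the left side into the kernel of `K ⊗ Z → F ⊗ Z`.
As `F` and `Q i` are flat, this kernel and that of `K ⊗ Z → K ⊗ Q i` both equal the kernel of the
diagonal `K ⊗ Z → F ⊗ Q i`. -/
theorem nonempty_torModule_shift_left {K F A : Type u} [AddCommGroup K] [Module R K]
    [AddCommGroup F] [Module R F] [AddCommGroup A] [Module R A] [Module.Flat R F]
    (f : K →ₗ[R] F) (hf : Function.Injective f) (p : F →ₗ[R] A) (hp : Function.Surjective p)
    (hfp : Function.Exact f p) (B : Type u) [AddCommGroup B] [Module R B] (i : ℕ) :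
    Nonempty (torModule R (i + 2) A B ≃ₗ[R] torModule R (i + 1) K B) := by
  obtain ⟨Q, d, π, hQ, -, -, hd, hT⟩ := exists_flat_resolution (R := R) B
  have := hQ (i + 1)
  obtain ⟨e⟩ := hT A (i + 1)
  obtain ⟨e''⟩ := hT K i
  obtain ⟨e'⟩ := nonempty_ker_rTensor_equiv_ker_lTensor f hf p hp hfp
    (LinearMap.range (d (i + 1))).subtype (Submodule.injective_subtype _) (d i).rangeRestrict
    (d i).surjective_rangeRestrict
    (by rw [LinearMap.exact_iff, Submodule.range_subtype, LinearMap.ker_rangeRestrict]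
        exact (hd i).linearMap_ker_eq)
  have hinj := Module.Flat.lTensor_preserves_injective_linearMap (M := F)
    (LinearMap.range (d i)).subtype (Submodule.injective_subtype _)
  have := hQ i
  have hinj' := Module.Flat.rTensor_preserves_injective_linearMap (M := Q i) f hf
  have hk : LinearMap.ker (f.rTensor (LinearMap.range (d i))) =
      LinearMap.ker ((LinearMap.range (d i)).subtype.lTensor K) := by
    rw [← LinearMap.ker_comp_of_ker_eq_bot _ (LinearMap.ker_eq_bot.2 hinj),
      LinearMap.lTensor_comp_rTensor, ← LinearMap.rTensor_comp_lTensor]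
    exact LinearMap.ker_comp_of_ker_eq_bot _ (LinearMap.ker_eq_bot.2 hinj')
  exact ⟨e.trans (e'.symm.trans ((LinearEquiv.ofEq _ _ hk).trans e''.symm))⟩

/-- A finite module over a Noetherian ring has a presentation by a finite free module. -/
theorem exists_free_presentation [IsNoetherianRing R] (A : Type u) [AddCommGroup A] [Module R A]
    [Module.Finite R A] :
    ∃ (F : ModuleCat.{u} R) (K : Submodule R F) (p : F →ₗ[R] A), Module.Finite R F ∧
      Module.Flat R F ∧ Function.Surjective p ∧ Function.Exact K.subtype p := by
  obtain ⟨r, p, hp⟩ := Module.Finite.exists_fin' R A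
  refine ⟨ModuleCat.of R (Fin r → R), LinearMap.ker p, p,
    (inferInstance : Module.Finite R (Fin r → R)), (inferInstance : Module.Flat R (Fin r → R)),
    hp, ?_⟩
  rw [LinearMap.exact_iff, Submodule.range_subtype]

/-- Every module has a presentation by a flat module. -/
theorem exists_flat_presentation (A : Type u) [AddCommGroup A] [Module R A] :
    ∃ (F : ModuleCat.{u} R) (K : Submodule R F) (p : F →ₗ[R] A),
      Module.Flat R F ∧ Function.Surjective p ∧ Function.Exact K.subtype p := by
  let p : (A →₀ R) →ₗ[R] A := Finsupp.linearCombination R id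
  refine ⟨ModuleCat.of R (A →₀ R), LinearMap.ker p, p,
    (inferInstance : Module.Flat R (A →₀ R)), Finsupp.linearCombination_id_surjective R A, ?_⟩
  rw [LinearMap.exact_iff, Submodule.range_subtype]

/-- Shifts in the first variable reduce everything to `Tor₂` and `Tor₁`, where the balancing of
`Tor₁` moves the syzygy to the other side. -/
theorem nonempty_torModule_shift_right {K F B : Type u} [AddCommGroup K] [Module R K]
    [AddCommGroup F] [Module R F] [AddCommGroup B] [Module R B] [Module.Flat R F]
    (f : K →ₗ[R] F) (hf : Function.Injective f) (p : F →ₗ[R] B) (hp : Function.Surjective p)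
    (hfp : Function.Exact f p) (i : ℕ) (A : Type u) [AddCommGroup A] [Module R A] :
    Nonempty (torModule R (i + 2) A B ≃ₗ[R] torModule R (i + 1) A K) := by
  induction i generalizing A with
  | zero =>
    obtain ⟨G, S, pA, hG, hpA, hS⟩ := exists_flat_presentation (R := R) A
    obtain ⟨H, V, pS, hH, hpS, hV⟩ := exists_flat_presentation (R := R) S
    obtain ⟨e₁⟩ := nonempty_torModule_shift_left S.subtype S.injective_subtype pA hpA hS B 0
    obtain ⟨e₂⟩ := nonempty_torModule_one_equiv_ker_rTensor S.subtype S.injective_subtype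
      pA hpA hS K
    obtain ⟨e₃⟩ := nonempty_torModule_one_equiv_ker_rTensor V.subtype V.injective_subtype
      pS hpS hV B
    obtain ⟨e₄⟩ := nonempty_ker_rTensor_equiv_ker_lTensor V.subtype V.injective_subtype
      pS hpS hV f hf p hp hfp
    have hinj := Module.Flat.lTensor_preserves_injective_linearMap (M := G) f hf
    have hinj' := Module.Flat.rTensor_preserves_injective_linearMap (M := F) S.subtype
      S.injective_subtype
    have hk : LinearMap.ker (f.lTensor S) = LinearMap.ker (S.subtype.rTensor K) := by
      rw [← LinearMap.ker_comp_of_ker_eq_bot (S.subtype.rTensor K) (LinearMap.ker_eq_bot.2 hinj),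
        LinearMap.lTensor_comp_rTensor, ← LinearMap.rTensor_comp_lTensor]
      exact (LinearMap.ker_comp_of_ker_eq_bot _ (LinearMap.ker_eq_bot.2 hinj')).symm
    exact ⟨e₁.trans (e₃.trans (e₄.trans ((LinearEquiv.ofEq _ _ hk).trans e₂.symm)))⟩
  | succ i ih =>
    obtain ⟨G, S, pA, hG, hpA, hS⟩ := exists_flat_presentation (R := R) A
    obtain ⟨e₁⟩ := nonempty_torModule_shift_left S.subtype S.injective_subtype pA hpA hS B (i + 1)
    obtain ⟨e₂⟩ := nonempty_torModule_shift_left S.subtype S.injective_subtype pA hpA hS K i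
    obtain ⟨e₃⟩ := ih S
    exact ⟨e₁.trans (e₃.trans e₂.symm)⟩

/-- `Tor_{i+1}(A, -)` is the kernel of `K ⊗ - → F ⊗ -` for a syzygy module `K` of `A`. -/
theorem exists_torModule_equiv_ker_left [IsNoetherianRing R] (i : ℕ) (A : Type u)
    [AddCommGroup A] [Module R A] [Module.Finite R A] :
    ∃ (F : ModuleCat.{u} R) (K : Submodule R F), Module.Finite R F ∧ ∀ (B : Type u) [AddCommGroup B] [Module R B],
      Nonempty (torModule R (i + 1) A B ≃ₗ[R] LinearMap.ker (K.subtype.rTensor B)) := by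
  induction i generalizing A with
  | zero =>
    obtain ⟨F, K, p, hF, hFf, hp, hK⟩ := exists_free_presentation (R := R) A
    exact ⟨F, K, hF, fun B _ _ => nonempty_torModule_one_equiv_ker_rTensor K.subtype
      (Submodule.injective_subtype _) p hp hK B⟩
  | succ i ih =>
    obtain ⟨F, K, p, hF, hFf, hp, hK⟩ := exists_free_presentation (R := R) A
    obtain ⟨H, L, hH, h⟩ := ih K
    refine ⟨H, L, hH, fun B _ _ => ?_⟩
    obtain ⟨e⟩ := nonempty_torModule_shift_left K.subtype
      (Submodule.injective_subtype _) p hp hK B i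
    obtain ⟨e'⟩ := h B
    exact ⟨e.trans e'⟩

/-- `Tor_{i+1}(-, B)` is the kernel of `K ⊗ - → F ⊗ -` for a syzygy module `K` of `B`. -/
theorem exists_torModule_equiv_ker_right [IsNoetherianRing R] (i : ℕ) (B : Type u)
    [AddCommGroup B] [Module R B] [Module.Finite R B] :
    ∃ (F : ModuleCat.{u} R) (K : Submodule R F), Module.Finite R F ∧ ∀ (A : Type u) [AddCommGroup A] [Module R A],
      Nonempty (torModule R (i + 1) A B ≃ₗ[R] LinearMap.ker (K.subtype.rTensor A)) := by
  induction i generalizing B with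
  | zero =>
    obtain ⟨F, K, p, hF, hFf, hp, hK⟩ := exists_free_presentation (R := R) B
    refine ⟨F, K, hF, fun A _ _ => ?_⟩
    obtain ⟨G, S, pA, hG, hpA, hS⟩ := exists_flat_presentation (R := R) A
    obtain ⟨e₁⟩ := nonempty_torModule_one_equiv_ker_rTensor S.subtype S.injective_subtype
      pA hpA hS B
    obtain ⟨e₂⟩ := nonempty_ker_rTensor_equiv_ker_lTensor S.subtype S.injective_subtype
      pA hpA hS K.subtype K.injective_subtype p hp hK
    have hk : LinearMap.ker (K.subtype.lTensor A) =
        (LinearMap.ker (K.subtype.rTensor A)).comap (TensorProduct.comm R A K).toLinearMap := by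
      ext x
      rw [Submodule.mem_comap, LinearMap.mem_ker, LinearMap.mem_ker, LinearMap.lTensor,
        LinearMap.rTensor, LinearEquiv.coe_coe, TensorProduct.map_comm,
        LinearEquiv.map_eq_zero_iff]
    exact ⟨e₁.trans (e₂.trans ((LinearEquiv.ofEq _ _ hk).trans
      ((TensorProduct.comm R A K).ofSubmodule' _)))⟩
  | succ i ih =>
    obtain ⟨F, K, p, hF, hFf, hp, hK⟩ := exists_free_presentation (R := R) B
    obtain ⟨H, L, hH, h⟩ := ih K
    refine ⟨H, L, hH, fun A _ _ => ?_⟩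
    obtain ⟨e⟩ := nonempty_torModule_shift_right K.subtype
      (Submodule.injective_subtype _) p hp hK i A
    obtain ⟨e'⟩ := h A
    exact ⟨e.trans e'⟩

end Tor

/-! ### Growth of finitely generated algebras over a field. -/

section Growth

/-- A chain of primes of `A` lifts to `S` by lying over and going up. -/
theorem ringKrullDim_le_of_isIntegral_of_injective {A S : Type*} [CommRing A] [CommRing S]
    [Algebra A S] [Algebra.IsIntegral A S] (h : Function.Injective (algebraMap A S)) :
    ringKrullDim A ≤ ringKrullDim S := by
  have := Algebra.HasGoingUp.of_isIntegral (R := A) (S := S)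
  refine iSup_le fun l => ?_
  obtain ⟨P, -, hP, hPl⟩ := Ideal.exists_ideal_over_prime_of_isIntegral (S := S) l.head.asIdeal ⊥
    (by rw [← RingHom.ker_eq_comap_bot, (RingHom.injective_iff_ker_eq_bot _).1 h]; exact bot_le)
  have : P.LiesOver l.head.asIdeal := ⟨hPl.symm⟩
  obtain ⟨L, hL, -⟩ := Ideal.exists_ltSeries_of_hasGoingUp l P
  rw [← hL]
  exact le_iSup (fun L : LTSeries (PrimeSpectrum S) => ((L.length : ℕ∞) : WithBot ℕ∞)) L

variable {k S : Type*} [Field k] [CommRing S] [Algebra k S]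

/-- The span of the products `g p * b`, for `p` of degree at most `e` and `b` in a set `w`. -/
def polySpan {s : ℕ} (g : MvPolynomial (Fin s) k →ₐ[k] S) (w : Set S) (e : ℕ) : Submodule k S :=
  Submodule.span k {y | ∃ p : MvPolynomial (Fin s) k, p.totalDegree ≤ e ∧ ∃ b ∈ w, y = g p * b}

theorem polySpan_mono {s : ℕ} (g : MvPolynomial (Fin s) k →ₐ[k] S) (w : Set S) {e e' : ℕ}
    (h : e ≤ e') : polySpan g w e ≤ polySpan g w e' := by
  refine Submodule.span_mono ?_
  rintro y ⟨p, hp, b, hb, rfl⟩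
  exact ⟨p, hp.trans h, b, hb, rfl⟩

theorem exists_mem_polySpan {s : ℕ} (g : MvPolynomial (Fin s) k →ₐ[k] S) (w : Finset S)
    (hw : ∀ x : S, ∃ c : S → MvPolynomial (Fin s) k, x = ∑ b ∈ w, g (c b) * b) (x : S) :
    ∃ e, x ∈ polySpan g (w : Set S) e := by
  obtain ⟨c, rfl⟩ := hw x
  refine ⟨w.sup fun b => (c b).totalDegree, Submodule.sum_mem _ fun b hb => ?_⟩
  exact Submodule.subset_span ⟨c b, Finset.le_sup (f := fun b => (c b).totalDegree) hb, b, hb, rfl⟩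

/-- `D` is the largest degree among the finitely many coefficients expressing the products `x * b`,
`b ∈ w`, in terms of `w`. -/
theorem exists_mul_mem_polySpan {s : ℕ} (g : MvPolynomial (Fin s) k →ₐ[k] S) (w : Finset S)
    (hw : ∀ x : S, ∃ c : S → MvPolynomial (Fin s) k, x = ∑ b ∈ w, g (c b) * b) (x : S) :
    ∃ D, ∀ e, ∀ y ∈ polySpan g (w : Set S) e, x * y ∈ polySpan g (w : Set S) (e + D) := by
  choose c hc using fun b : S => hw (x * b)
  refine ⟨w.sup fun b => w.sup fun b' => (c b b').totalDegree, fun e y hy => ?_⟩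
  refine Submodule.span_induction ?_ (by simp) (fun y z _ _ hy hz => by
    rw [mul_add]; exact Submodule.add_mem _ hy hz) (fun a y _ hy => by
    rw [mul_smul_comm]; exact Submodule.smul_mem _ _ hy) hy
  rintro y ⟨p, hp, b, hb, rfl⟩
  rw [mul_left_comm, hc b, Finset.mul_sum]
  refine Submodule.sum_mem _ fun b' hb' => Submodule.subset_span
    ⟨p * c b b', (MvPolynomial.totalDegree_mul _ _).trans (add_le_add hp ?_), b', hb', ?_⟩
  · exact (Finset.le_sup (f := fun b' => (c b b').totalDegree) hb').trans
      (Finset.le_sup (f := fun b => w.sup fun b' => (c b b').totalDegree) hb)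
  · rw [map_mul, mul_assoc]

theorem exists_finset_polySpan_le {s : ℕ} (g : MvPolynomial (Fin s) k →ₐ[k] S) (w : Finset S)
    (e : ℕ) : ∃ T : Finset S, T.card ≤ w.card * (e + 1) ^ s ∧
      polySpan g (w : Set S) e ≤ Submodule.span k (T : Set S) := by
  classical
  let φ : S × (Fin s → Fin (e + 1)) → S := fun z =>
    g (MvPolynomial.monomial (Finsupp.equivFunOnFinite.symm fun j => (z.2 j : ℕ)) 1) * z.1
  refine ⟨(w ×ˢ Finset.univ).image φ, ?_, ?_⟩
  · refine Finset.card_image_le.trans ?_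
    rw [Finset.card_product]
    simp
  · refine Submodule.span_le.2 ?_
    rintro y ⟨p, hp, b, hb, rfl⟩
    rw [p.as_sum, map_sum, Finset.sum_mul]
    refine Submodule.sum_mem _ fun α hα => ?_
    have hα' : ∀ j, α j < e + 1 := fun j => Nat.lt_succ_of_le <|
      (Finsupp.le_degree j α).trans ((MvPolynomial.le_totalDegree hα).trans hp)
    have : MvPolynomial.monomial α (p.coeff α) =
        p.coeff α • MvPolynomial.monomial (Finsupp.equivFunOnFinite.symm fun j => α j) (1 : k) := by
      rw [show (Finsupp.equivFunOnFinite.symm fun j => α j) = α from Finsupp.ext fun _ => rfl,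
        MvPolynomial.smul_monomial, smul_eq_mul, mul_one]
    rw [this, map_smul, smul_mul_assoc]
    refine Submodule.smul_mem _ _ (Submodule.subset_span ?_)
    exact Finset.mem_coe.2 (Finset.mem_image.2 ⟨(b, fun j => ⟨α j, hα' j⟩),
      Finset.mem_product.2 ⟨hb, Finset.mem_univ _⟩, rfl⟩)

/-- The growth of a finitely generated algebra is bounded by its Krull dimension. -/
theorem exists_card_le_of_ringKrullDim_le [Algebra.FiniteType k S] (d : ℕ)
    (hd : ringKrullDim S ≤ d) (E : Finset S) :
    ∃ C : ℕ, ∀ n : ℕ, ∃ T : Finset S, T.card ≤ C * (n + 1) ^ d ∧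
      (Submodule.span k (E : Set S)) ^ n ≤ Submodule.span k (T : Set S) := by
  rcases subsingleton_or_nontrivial S with hS | hS
  · exact ⟨0, fun n => ⟨∅, by simp, fun x _ => by
      rw [Subsingleton.elim x 0]; exact Submodule.zero_mem _⟩⟩
  obtain ⟨s, g, hg, hfin⟩ := exists_finite_inj_algHom_of_fg k S
  replace hfin : g.toRingHom.Finite := hfin
  -- The polynomial ring in `s` variables, of dimension `s`, embeds integrally in `S`.
  have hs : s ≤ d := by
    algebraize [g.toRingHom]
    have h1 := ringKrullDim_le_of_isIntegral_of_injective (A := MvPolynomial (Fin s) k) (S := S) hg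
    rw [MvPolynomial.ringKrullDim_of_isNoetherianRing, ringKrullDim_eq_zero_of_field,
      zero_add, Nat.card_fin] at h1
    exact_mod_cast h1.trans hd
  obtain ⟨w, hw⟩ : ∃ w : Finset S, ∀ x : S,
      ∃ c : S → MvPolynomial (Fin s) k, x = ∑ b ∈ w, g (c b) * b := by
    algebraize [g.toRingHom]
    obtain ⟨w, hw⟩ := Module.Finite.fg_top (R := MvPolynomial (Fin s) k) (M := S)
    refine ⟨w, fun x => ?_⟩
    have hx : x ∈ Submodule.span (MvPolynomial (Fin s) k) (w : Set S) := by rw [hw]; trivial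
    obtain ⟨c, -, hc⟩ := Submodule.mem_span_finset.1 hx
    exact ⟨c, hc.symm⟩
  -- `1` has filtration degree at most `e₀`, and each factor from `E` raises the degree by at most
  -- `E.sup D`.
  obtain ⟨e₀, he₀⟩ := exists_mem_polySpan g w hw 1
  choose D hD using exists_mul_mem_polySpan g w hw
  have hpow : ∀ n, (Submodule.span k (E : Set S)) ^ n ≤
      polySpan g (w : Set S) (e₀ + n * E.sup D) := by
    intro n
    induction n with
    | zero =>
      rw [pow_zero, Submodule.one_le]
      simpa using he₀
    | succ n ih =>
      rw [pow_succ', Submodule.mul_le]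
      intro x hx y hy
      have hy := ih hy
      rw [show e₀ + (n + 1) * E.sup D = (e₀ + n * E.sup D) + E.sup D by ring]
      refine Submodule.span_induction ?_ (by simp) (fun a b _ _ ha hb => by
        rw [add_mul]; exact Submodule.add_mem _ ha hb) (fun a b _ hb => by
        rw [smul_mul_assoc]; exact Submodule.smul_mem _ _ hb) hx
      intro a ha
      exact polySpan_mono g _ (Nat.add_le_add_left (Finset.le_sup ha) _) (hD a _ y hy)
  refine ⟨w.card * (e₀ + E.sup D + 1) ^ s, fun n => ?_⟩
  obtain ⟨T, hT, hT'⟩ := exists_finset_polySpan_le g w (e₀ + n * E.sup D)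
  refine ⟨T, hT.trans ?_, (hpow n).trans hT'⟩
  rw [mul_assoc]
  refine Nat.mul_le_mul_left _ ?_
  calc (e₀ + n * E.sup D + 1) ^ s ≤ ((e₀ + E.sup D + 1) * (n + 1)) ^ s :=
        Nat.pow_le_pow_left (by nlinarith [Nat.zero_le (e₀ * n), Nat.zero_le n]) _
    _ = (e₀ + E.sup D + 1) ^ s * (n + 1) ^ s := mul_pow _ _ _
    _ ≤ _ := Nat.mul_le_mul_left _ (Nat.pow_le_pow_right (Nat.succ_pos _) hs)

end Growth

/-! ### Relative lengths of submodules. -/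

section RelLength

variable {R X Y : Type*} [CommRing R] [AddCommGroup X] [Module R X] [AddCommGroup Y] [Module R Y]

/-- The length of `A / (A ∩ B)`, for submodules `A` and `B` of a module. -/
noncomputable def relLength (A B : Submodule R X) : ℕ∞ := Module.length R (A.map B.mkQ)

theorem relLength_mono_left {A A' : Submodule R X} (B : Submodule R X) (h : A ≤ A') :
    relLength A B ≤ relLength A' B :=
  Module.length_le_of_injective (Submodule.inclusion (Submodule.map_mono h))
    (Submodule.inclusion_injective _)

/-- The triangle inequality for relative lengths, along a linear map. -/
theorem relLength_le_add_of_map (φ : X →ₗ[R] Y) (A B C : Submodule R X) (D : Submodule R Y)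
    (hB : B ≤ D.comap φ) (hC : ∀ x ∈ A, φ x ∈ D → x ∈ C ⊔ B) :
    relLength A B ≤ relLength (A.map φ) D + relLength C B := by
  let ψ : (X ⧸ B) →ₗ[R] (Y ⧸ D) := Submodule.mapQ B D φ hB
  -- Length is additive along the kernel and range of `f`: the range lies in the image of `A.map φ`
  -- modulo `D`, the kernel in the image of `C` modulo `B`.
  let f : (A.map B.mkQ) →ₗ[R] (Y ⧸ D) := ψ ∘ₗ (A.map B.mkQ).subtype
  have h := Module.length_eq_add_of_exact (N := LinearMap.ker f) (M := A.map B.mkQ)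
    (P := LinearMap.range f) (LinearMap.ker f).subtype f.rangeRestrict
    (Submodule.injective_subtype _) f.surjective_rangeRestrict
    (by rw [LinearMap.exact_iff, Submodule.range_subtype, LinearMap.ker_rangeRestrict])
  rw [relLength, h, add_comm]
  refine add_le_add ?_ ?_
  · refine Module.length_le_of_injective (Submodule.inclusion ?_) (Submodule.inclusion_injective _)
    rintro _ ⟨⟨_, ⟨x, hx, rfl⟩⟩, rfl⟩
    exact ⟨φ x, ⟨x, hx, rfl⟩, rfl⟩
  · have : ∀ z : LinearMap.ker f, ((z : A.map B.mkQ) : X ⧸ B) ∈ C.map B.mkQ := by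
      rintro ⟨⟨_, ⟨x, hx, rfl⟩⟩, hz⟩
      have hz' : φ x ∈ D := by
        rw [← Submodule.Quotient.mk_eq_zero]
        exact hz
      obtain ⟨c, hc, b, hb, hcb⟩ := Submodule.mem_sup.1 (hC x hx hz')
      refine ⟨c, hc, ?_⟩
      exact (Submodule.Quotient.eq B).2 (by rw [← hcb]; simpa using hb)
    refine Module.length_le_of_injective
      (((A.map B.mkQ).subtype ∘ₗ (LinearMap.ker f).subtype).codRestrict _ this) ?_
    intro a b hab
    have hab' : ((a : A.map B.mkQ) : X ⧸ B) = ((b : A.map B.mkQ) : X ⧸ B) :=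
      congrArg (fun z : C.map B.mkQ => (z : X ⧸ B)) hab
    exact Subtype.ext (Subtype.ext hab')

theorem relLength_triangle (A B C : Submodule R X) (h : C ≤ B) :
    relLength A C ≤ relLength A B + relLength B C := by
  have := relLength_le_add_of_map LinearMap.id A C B B (by simpa using h)
    (fun x _ hx => Submodule.mem_sup_left hx)
  rwa [Submodule.map_id] at this

theorem relLength_anti_right (A : Submodule R X) {B C : Submodule R X} (h : C ≤ B) :
    relLength A B ≤ relLength A C := by
  refine Module.length_le_of_surjective
    (((Submodule.factor h) ∘ₗ (A.map C.mkQ).subtype).codRestrict (A.map B.mkQ) ?_) ?_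
  · rintro ⟨_, ⟨x, hx, rfl⟩⟩
    exact ⟨x, hx, rfl⟩
  · rintro ⟨_, ⟨x, hx, rfl⟩⟩
    exact ⟨⟨_, ⟨x, hx, rfl⟩⟩, rfl⟩

theorem relLength_self (A : Submodule R X) : relLength A A = 0 := by
  rw [relLength, Submodule.mkQ_map_self, Module.length_eq_zero_iff]
  infer_instance

theorem relLength_le_length (A B : Submodule R X) : relLength A B ≤ Module.length R A := by
  refine Module.length_le_of_surjective ((B.mkQ ∘ₗ A.subtype).codRestrict (A.map B.mkQ) ?_) ?_
  · rintro ⟨x, hx⟩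
    exact ⟨x, hx, rfl⟩
  · rintro ⟨_, ⟨x, hx, rfl⟩⟩
    exact ⟨⟨x, hx⟩, rfl⟩

/-- A module killed by a maximal ideal has length at most the number of its generators. -/
theorem length_span_le_card (P : Ideal R) [hP : P.IsMaximal] (T : Finset X)
    (hT : ∀ r ∈ P, ∀ x ∈ T, r • x = 0) :
    Module.length R (Submodule.span R (T : Set X)) ≤ T.card := by
  classical
  let g : T → (R ⧸ P) →ₗ[R] X := fun t =>
    Submodule.liftQ P (LinearMap.toSpanSingleton R X t) fun r hr => by
      rw [LinearMap.mem_ker, LinearMap.toSpanSingleton_apply]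
      exact hT r hr t t.2
  let f : (T → R ⧸ P) →ₗ[R] X := ∑ t, g t ∘ₗ LinearMap.proj t
  have hf : Submodule.span R (T : Set X) ≤ LinearMap.range f := by
    refine Submodule.span_le.2 fun t ht => ⟨Pi.single ⟨t, ht⟩ 1, ?_⟩
    simp only [f, LinearMap.sum_apply, LinearMap.comp_apply, LinearMap.proj_apply]
    rw [Finset.sum_eq_single (⟨t, ht⟩ : T)]
    · rw [Pi.single_eq_same]
      change (1 : R) • t = t
      exact one_smul _ _
    · intro b _ hb
      rw [Pi.single_eq_of_ne hb, map_zero]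
    · intro h; exact absurd (Finset.mem_univ _) h
  have : IsSimpleModule R (R ⧸ P) := isSimpleModule_iff_isCoatom.2 hP.out
  calc Module.length R (Submodule.span R (T : Set X))
      ≤ Module.length R (LinearMap.range f) :=
        Module.length_le_of_injective (Submodule.inclusion hf) (Submodule.inclusion_injective _)
    _ ≤ Module.length R (T → R ⧸ P) :=
        Module.length_le_of_surjective f.rangeRestrict f.surjective_rangeRestrict
    _ = T.card := by
        rw [Module.length_pi_of_fintype]
        simp [Module.length_eq_one]

theorem relLength_smul_lt_top (P : Ideal R) [P.IsMaximal] {A : Submodule R X} (hA : A.FG) :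
    relLength A (P • A) < ⊤ := by
  classical
  obtain ⟨T, rfl⟩ := hA
  have h := length_span_le_card P (T.image (P • Submodule.span R (T : Set X)).mkQ) (by
    intro r hr x hx
    obtain ⟨t, ht, rfl⟩ := Finset.mem_image.1 hx
    rw [← map_smul, Submodule.mkQ_apply, Submodule.Quotient.mk_eq_zero]
    exact Submodule.smul_mem_smul hr (Submodule.subset_span ht))
  rw [Finset.coe_image, ← Submodule.map_span] at h
  exact lt_of_le_of_lt h (ENat.natCast_lt_top _)

theorem relLength_pow_smul_lt_top [IsNoetherianRing R] (P : Ideal R) [P.IsMaximal] (k : ℕ)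
    {A : Submodule R X} (hA : A.FG) : relLength A (P ^ k • A) < ⊤ := by
  induction k generalizing A with
  | zero => rw [pow_zero, Ideal.one_eq_top, Submodule.top_smul, relLength_self]; exact ENat.top_pos
  | succ k ih =>
    have hle : P ^ (k + 1) • A ≤ P • A := Submodule.smul_mono_left (Ideal.pow_le_self (by simp))
    refine lt_of_le_of_lt (relLength_triangle A (P • A) _ hle) (WithTop.add_lt_top.2
      ⟨relLength_smul_lt_top P hA, ?_⟩)
    rw [pow_succ, Submodule.mul_smul]
    exact ih (Submodule.FG.smul (IsNoetherian.noetherian P) hA)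

theorem length_lt_top_of_pow_smul_eq_bot [IsNoetherianRing R] (P : Ideal R) [P.IsMaximal] (k : ℕ)
    [Module.Finite R X] (h : ∀ r ∈ P ^ k, ∀ x : X, r • x = 0) : Module.length R X < ⊤ := by
  have h1 := relLength_pow_smul_lt_top P k (A := (⊤ : Submodule R X)) Module.Finite.fg_top
  have h0 : P ^ k • (⊤ : Submodule R X) = ⊥ := by
    rw [eq_bot_iff, Submodule.smul_le]
    intro r hr x _
    exact h r hr x
  rw [h0] at h1
  refine lt_of_le_of_lt ?_ h1
  refine Module.length_le_of_injective
    ((Submodule.mkQ ⊥).codRestrict _ fun x => ⟨x, trivial, rfl⟩) ?_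
  intro a b hab
  have := (Submodule.Quotient.eq _).1 (congrArg Subtype.val hab)
  exact sub_eq_zero.1 ((Submodule.mem_bot R).1 this)

end RelLength

/-! ### Growth of algebras over a local ring modulo the maximal ideal. -/

section Fiber

/-- Growth of a finitely generated algebra over a local ring that is killed by the maximal ideal. -/
theorem exists_card_le_of_maximalIdeal_smul_eq_zero {R S : Type*} [CommRing R] [IsLocalRing R]
    [CommRing S] [Algebra R S] [Algebra.FiniteType R S]
    (hS : ∀ r ∈ IsLocalRing.maximalIdeal R, algebraMap R S r = 0) (d : ℕ)
    (hd : ringKrullDim S ≤ d) (E : Finset S) :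
    ∃ C : ℕ, ∀ n : ℕ, ∃ T : Finset S, T.card ≤ C * (n + 1) ^ d ∧
      (Submodule.span R (E : Set S)) ^ n ≤ Submodule.span R (T : Set S) := by
  let _ : Algebra (IsLocalRing.ResidueField R) S :=
    (Ideal.Quotient.lift (IsLocalRing.maximalIdeal R) (algebraMap R S) hS).toAlgebra
  have : IsScalarTower R (IsLocalRing.ResidueField R) S := IsScalarTower.of_algebraMap_eq fun _ => rfl
  have : Algebra.FiniteType (IsLocalRing.ResidueField R) S :=
    Algebra.FiniteType.of_restrictScalars_finiteType R _ S
  have hspan : ∀ s : Set S, (Submodule.span (IsLocalRing.ResidueField R) s).restrictScalars R =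
      Submodule.span R s := fun s =>
    Submodule.restrictScalars_span R _ IsLocalRing.residue_surjective s
  obtain ⟨C, hC⟩ := exists_card_le_of_ringKrullDim_le (k := IsLocalRing.ResidueField R) d hd E
  refine ⟨C, fun n => ?_⟩
  obtain ⟨T, hT, hT'⟩ := hC n
  refine ⟨T, hT, ?_⟩
  rw [Submodule.span_pow, ← hspan, ← hspan, ← Submodule.span_pow]
  exact hT'

theorem exists_card_le_of_ringKrullDim_quotient_le {R S : Type*} [CommRing R] [IsLocalRing R]
    [CommRing S] [Algebra R S] [Algebra.FiniteType R S] (b : Ideal S)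
    (hb : ∀ r ∈ IsLocalRing.maximalIdeal R, algebraMap R S r ∈ b) (d : ℕ)
    (hd : ringKrullDim (S ⧸ b) ≤ d) (E : Finset S) :
    ∃ C : ℕ, ∀ n : ℕ, ∃ T : Finset S, T.card ≤ C * (n + 1) ^ d ∧
      ∀ x ∈ (Submodule.span R (E : Set S)) ^ n,
        ∃ y ∈ Submodule.span R (T : Set S), x - y ∈ b := by
  classical
  have : Algebra.FiniteType R (S ⧸ b) :=
    Algebra.FiniteType.of_surjective (Ideal.Quotient.mkₐ R b) Ideal.Quotient.mk_surjective
  obtain ⟨C, hC⟩ := exists_card_le_of_maximalIdeal_smul_eq_zero (R := R) (S := S ⧸ b)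
    (fun r hr => Ideal.Quotient.eq_zero_iff_mem.2 (hb r hr)) d hd
    (E.image (Ideal.Quotient.mkₐ R b))
  refine ⟨C, fun n => ?_⟩
  obtain ⟨T, hT, hT'⟩ := hC n
  refine ⟨T.image (Function.surjInv (Ideal.Quotient.mk_surjective (I := b))),
    Finset.card_image_le.trans hT, fun x hx => ?_⟩
  have hx' := hT' (x := Ideal.Quotient.mkₐ R b x) (by
    have := Submodule.mem_map_of_mem (f := (Ideal.Quotient.mkₐ R b).toLinearMap) hx
    rw [Submodule.map_pow, Submodule.map_span] at this
    rw [Finset.coe_image]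
    exact this)
  have himg : (T : Set (S ⧸ b)) = (Ideal.Quotient.mkₐ R b).toLinearMap ''
      (T.image (Function.surjInv (Ideal.Quotient.mk_surjective (I := b))) : Finset S) := by
    rw [Finset.coe_image, Set.image_image]
    conv_lhs => rw [← Set.image_id (T : Set (S ⧸ b))]
    refine Set.image_congr fun z _ => ?_
    exact (Function.surjInv_eq (Ideal.Quotient.mk_surjective (I := b)) z).symm
  rw [himg, ← Submodule.map_span] at hx'
  obtain ⟨y, hy, hyx⟩ := hx'
  exact ⟨y, hy, Ideal.Quotient.eq.1 hyx.symm⟩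

end Fiber

/-! ### The fiber cone and the analytic spread. -/

section FiberCone

open Polynomial IsLocalRing

variable {R : Type u} [CommRing R]

theorem finite_reesModule [IsNoetherianRing R] (I : Ideal R) (M : Type u) [AddCommGroup M]
    [Module R M] [Module.Finite R M] : Module.Finite (reesAlgebra I) (reesModule I M) := by
  rw [Module.Finite.iff_fg, Ideal.Filtration.submodule_fg_iff_stable]
  · exact I.stableFiltration_stable ⊤
  · intro i
    exact IsNoetherian.noetherian _

/-- The annihilator of the Rees module of `M`, enlarged by the maximal ideal of `R`. -/
noncomputable def fiberIdeal [IsLocalRing R] (I : Ideal R) (M : Type u) [AddCommGroup M]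
    [Module R M] : Ideal (reesAlgebra I) :=
  Module.annihilator (reesAlgebra I) (reesModule I M) ⊔
    (maximalIdeal R).map (algebraMap R (reesAlgebra I))

/-- The Rees module is finite, so the support of its fiber is the zero locus of its annihilator plus
the extension of `P`. -/
theorem analyticSpread_eq_ringKrullDim [IsLocalRing R] [IsNoetherianRing R] (I : Ideal R)
    (M : Type u) [AddCommGroup M] [Module R M] [Module.Finite R M] :
    analyticSpread I M = ringKrullDim (reesAlgebra I ⧸ fiberIdeal I M) := by
  have := finite_reesModule I M
  have h := Module.support_quotient (R := reesAlgebra I) (M := reesModule I M)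
    ((maximalIdeal R).map (algebraMap R (reesAlgebra I)))
  rw [Module.support_eq_zeroLocus (R := reesAlgebra I) (M := reesModule I M),
    ← PrimeSpectrum.zeroLocus_sup] at h
  rw [ringKrullDim_quotient, fiberIdeal, ← h]
  rfl

/-- Testing an annihilating element on the degree-zero part `M` shows that its coefficients kill
`M`. Hence `fiberIdeal` acts as zero on the fibers of any `U` killed by `ann M`. -/
theorem coeff_mem_of_mem_fiberIdeal [IsLocalRing R] (I : Ideal R) (M : Type u) [AddCommGroup M]
    [Module R M] {f : reesAlgebra I} (hf : f ∈ fiberIdeal I M) (j : ℕ) :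
    (f : R[X]).coeff j ∈ Module.annihilator R M ⊔ maximalIdeal R * I ^ j := by
  obtain ⟨a, ha, b, hb, rfl⟩ := Submodule.mem_sup.1 hf
  rw [Subalgebra.coe_add, coeff_add]
  refine Submodule.add_mem_sup ?_ ?_
  · rw [Module.mem_annihilator] at ha ⊢
    intro x
    have h := ha ⟨PolynomialModule.single R 0 x, fun i => by
      rw [PolynomialModule.coeff_single, Finsupp.single_apply]
      split_ifs with h
      · subst h; simp [Ideal.stableFiltration]
      · exact Submodule.zero_mem _⟩
    have h' := congrArg (fun z : reesModule I M => (z : PolynomialModule R M).coeff j) h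
    have h2 : ((a : R[X]) • PolynomialModule.single R 0 x).coeff j = 0 := h'
    rw [PolynomialModule.smul_single_apply] at h2
    simpa using h2
  · refine Submodule.span_induction
      (p := fun (b : reesAlgebra I) _ => ∀ j, (b : R[X]).coeff j ∈ maximalIdeal R * I ^ j)
      ?_ (by simp) (fun x y _ _ hx hy j => ?_) (fun c x hx ih j => ?_) hb j
    · rintro _ ⟨r, hr, rfl⟩ j
      change (C r : R[X]).coeff j ∈ _
      rw [coeff_C]
      split_ifs with h
      · subst h; simpa using hr
      · exact Submodule.zero_mem _
    · rw [Subalgebra.coe_add, coeff_add]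
      exact Submodule.add_mem _ (hx j) (hy j)
    · rw [smul_eq_mul, Subalgebra.coe_mul, coeff_mul]
      refine Submodule.sum_mem _ fun z hz => ?_
      rw [← Finset.HasAntidiagonal.mem_antidiagonal.1 hz, pow_add, mul_left_comm]
      exact Ideal.mul_mem_mul (c.2 z.1) (ih z.2)

/-- As `1 ∈ E`, the powers of the span increase, so the `m`-th one contains all degrees up to `m` at
once. This is why growth controls a sum over `j < m`. -/
theorem mk_monomial_mem_span_pow {I : Ideal R} {E : Set (reesAlgebra I)} (h1 : 1 ∈ E) {s : Finset R}
    (hs : Ideal.span (s : Set R) = I)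
    (hE : ∀ g ∈ s, ∀ h : monomial 1 g ∈ reesAlgebra I, ⟨monomial 1 g, h⟩ ∈ E)
    {j m : ℕ} (hjm : j ≤ m) {a : R} (ha : a ∈ I ^ j) (h : monomial j a ∈ reesAlgebra I) :
    (⟨monomial j a, h⟩ : reesAlgebra I) ∈ (Submodule.span R E) ^ m := by
  have hI : ∀ a ∈ I, ∀ h : monomial 1 a ∈ reesAlgebra I,
      (⟨monomial 1 a, h⟩ : reesAlgebra I) ∈ Submodule.span R E := by
    intro a ha
    rw [← hs] at ha
    refine Submodule.span_induction (p := fun a _ => ∀ h : monomial 1 a ∈ reesAlgebra I,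
      (⟨monomial 1 a, h⟩ : reesAlgebra I) ∈ Submodule.span R E) (fun g hg h => ?_) (fun h => ?_)
      (fun x y hx hy ihx ihy h => ?_) (fun c x hx ih h => ?_) ha
    · exact Submodule.subset_span (hE g hg h)
    · convert Submodule.zero_mem (Submodule.span R E)
      exact map_zero _
    · have hx' : monomial 1 x ∈ reesAlgebra I :=
        reesAlgebra.monomial_mem.2 (by rw [pow_one, ← hs]; exact hx)
      have hy' : monomial 1 y ∈ reesAlgebra I :=
        reesAlgebra.monomial_mem.2 (by rw [pow_one, ← hs]; exact hy)
      convert Submodule.add_mem _ (ihx hx') (ihy hy')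
      exact map_add _ _ _
    · have hx' : monomial 1 x ∈ reesAlgebra I :=
        reesAlgebra.monomial_mem.2 (by rw [pow_one, ← hs]; exact hx)
      convert Submodule.smul_mem _ c (ih hx')
      exact map_smul _ _ _
  have h1' : (1 : Submodule R (reesAlgebra I)) ≤ Submodule.span R E := by
    rw [Submodule.one_le]; exact Submodule.subset_span h1
  refine pow_le_pow_right₀ h1' hjm ?_
  clear hjm
  induction j generalizing a with
  | zero =>
    rw [pow_zero, Submodule.mem_one]
    exact ⟨a, Subtype.ext rfl⟩
  | succ j ih =>
    rw [pow_succ'] at ha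
    refine Submodule.mul_induction_on' (C := fun a _ => ∀ h : monomial (j + 1) a ∈ reesAlgebra I,
      (⟨monomial (j + 1) a, h⟩ : reesAlgebra I) ∈ (Submodule.span R E) ^ (j + 1))
      (fun x hx y hy h => ?_) (fun x hx y hy ihx ihy h => ?_) ha h
    · have hx' : monomial 1 x ∈ reesAlgebra I := reesAlgebra.monomial_mem.2 (by rwa [pow_one])
      have hy' : monomial j y ∈ reesAlgebra I := reesAlgebra.monomial_mem.2 hy
      rw [pow_succ']
      convert Submodule.mul_mem_mul (hI x hx hx') (ih hy hy')
      change _ = monomial 1 x * monomial j y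
      rw [monomial_mul_monomial, add_comm]
    · have hx' : monomial (j + 1) x ∈ reesAlgebra I :=
        reesAlgebra.monomial_mem.2 (by rwa [pow_succ'])
      have hy' : monomial (j + 1) y ∈ reesAlgebra I :=
        reesAlgebra.monomial_mem.2 (by rwa [pow_succ'])
      convert Submodule.add_mem _ (ihx hx') (ihy hy')
      exact map_add _ _ _

section Growth

variable [IsLocalRing R] [IsNoetherianRing R] {I : Ideal R} {M : Type u} [AddCommGroup M]
  [Module R M] [Module.Finite R M] {d : ℕ} {G : Type u} [AddCommGroup G] [Module R G]

theorem exists_card_le_span_pow_fiber (hd : analyticSpread I M ≤ d) (E : Finset (reesAlgebra I)) :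
    ∃ C : ℕ, ∀ n : ℕ, ∃ T : Finset (reesAlgebra I), T.card ≤ C * (n + 1) ^ d ∧
      ∀ x ∈ (Submodule.span R (E : Set (reesAlgebra I))) ^ n,
        ∃ y ∈ Submodule.span R (T : Set (reesAlgebra I)), x - y ∈ fiberIdeal I M := by
  have : Algebra.FiniteType R (reesAlgebra I) :=
    (Subalgebra.fg_iff_finiteType _).1 (reesAlgebra.fg (IsNoetherian.noetherian I))
  exact exists_card_le_of_ringKrullDim_quotient_le (fiberIdeal I M)
    (fun r hr => Submodule.mem_sup_right (Ideal.mem_map_of_mem _ hr)) d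
    ((analyticSpread_eq_ringKrullDim I M).symm.le.trans hd) E

/-- The fiber `⨁ I ^ j U / P I ^ j U` of a submodule `U` killed by the annihilator of `M` has growth
bounded by the analytic spread of `I` on `M`. -/
theorem exists_sum_relLength_smul_le (hd : analyticSpread I M ≤ d) (U : Submodule R G)
    (hU : U.FG) (hann : ∀ r ∈ Module.annihilator R M, ∀ u ∈ U, r • u = 0) :
    ∃ C : ℕ, ∀ m : ℕ,
      ∑ j ∈ Finset.range m, relLength (I ^ j • U) (maximalIdeal R • I ^ j • U) ≤
        ((C * (m + 1) ^ d : ℕ) : ℕ∞) := by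
  classical
  obtain ⟨s, hs⟩ : I.FG := IsNoetherian.noetherian I
  obtain ⟨t, rfl⟩ := hU
  have hgen : ∀ g ∈ s, monomial 1 g ∈ reesAlgebra I := fun g hg =>
    reesAlgebra.monomial_mem.2 (by rw [pow_one, ← hs]; exact Submodule.subset_span hg)
  let E : Finset (reesAlgebra I) :=
    insert 1 (s.attach.image fun g => ⟨monomial 1 g.1, hgen g.1 g.2⟩)
  obtain ⟨C, hC⟩ := exists_card_le_span_pow_fiber hd E
  refine ⟨t.card * C, fun m => ?_⟩
  obtain ⟨T, hT, hT'⟩ := hC m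
  set U := Submodule.span R (t : Set G) with hU
  -- `Ψ b` sends `f` to the classes of `f_j b` for all `j < m` together; a single target makes the
  -- sum of the fiber lengths the length of one submodule.
  let Ψ : G → reesAlgebra I →ₗ[R] (∀ j : Fin m, G ⧸ (maximalIdeal R • I ^ (j : ℕ) • U)) := fun b =>
    LinearMap.pi fun j => (Submodule.mkQ _) ∘ₗ (LinearMap.toSpanSingleton R G b) ∘ₗ
      (lcoeff R (j : ℕ)) ∘ₗ (reesAlgebra I).val.toLinearMap
  have hΨ : ∀ b f j, Ψ b f j = Submodule.Quotient.mk ((f : R[X]).coeff (j : ℕ) • b) :=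
    fun b f j => rfl
  have hmem : ∀ b ∈ U, ∀ j : ℕ, ∀ a ∈ maximalIdeal R * I ^ j,
      a • b ∈ maximalIdeal R • I ^ j • U := fun b hb j a ha => by
    rw [← Submodule.mul_smul]; exact Submodule.smul_mem_smul ha hb
  have hΨ0 : ∀ b ∈ U, ∀ f ∈ fiberIdeal I M, Ψ b f = 0 := by
    intro b hb f hf
    funext j
    obtain ⟨x, hx, y, hy, hxy⟩ := Submodule.mem_sup.1 (coeff_mem_of_mem_fiberIdeal I M hf j)
    rw [hΨ, ← hxy, add_smul, hann x hx b hb, zero_add]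
    exact (Submodule.Quotient.mk_eq_zero _).2 (hmem b hb j y hy)
  let V : Finset (∀ j : Fin m, G ⧸ (maximalIdeal R • I ^ (j : ℕ) • U)) :=
    (t ×ˢ T).image fun z => Ψ z.1 z.2
  have hΨV : ∀ b ∈ t, ∀ f ∈ (Submodule.span R (E : Set (reesAlgebra I))) ^ m,
      Ψ b f ∈ Submodule.span R (V : Set (∀ j : Fin m, _)) := by
    intro b hb f hf
    obtain ⟨y, hy, hfy⟩ := hT' f hf
    have h0 := hΨ0 b (Submodule.subset_span hb) _ hfy
    rw [map_sub, sub_eq_zero] at h0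
    rw [h0]
    have := Submodule.mem_map_of_mem (f := Ψ b) hy
    rw [Submodule.map_span] at this
    refine Submodule.span_mono ?_ this
    rintro _ ⟨τ, hτ, rfl⟩
    exact Finset.mem_coe.2 (Finset.mem_image.2 ⟨(b, τ), Finset.mem_product.2 ⟨hb, hτ⟩, rfl⟩)
  -- For `a ∈ I ^ j` and a generator `b`, the class of `a • b` placed in slot `j` is the value of `Ψ
  -- b` at the monomial of degree `j` with coefficient `a`.
  have hsingle : ∀ j : Fin m, ∀ y ∈ (I ^ (j : ℕ) • U).map (Submodule.mkQ
      (maximalIdeal R • I ^ (j : ℕ) • U)),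
      (Pi.single j y : ∀ j : Fin m, G ⧸ (maximalIdeal R • I ^ (j : ℕ) • U)) ∈
        Submodule.span R (V : Set (∀ j : Fin m, _)) := by
    rintro j _ ⟨y, hy, rfl⟩
    rw [SetLike.mem_coe] at hy
    let σ : G →ₗ[R] (∀ j : Fin m, G ⧸ (maximalIdeal R • I ^ (j : ℕ) • U)) :=
      LinearMap.single R _ j ∘ₗ Submodule.mkQ _
    change y ∈ (Submodule.span R (V : Set (∀ j : Fin m, _))).comap σ
    refine (Submodule.smul_le.2 fun a ha u hu => ?_ :
      I ^ (j : ℕ) • U ≤ (Submodule.span R (V : Set (∀ j : Fin m, _))).comap σ) hy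
    refine Submodule.span_induction ?_ (by simp) (fun x y _ _ hx hy => by
      rw [smul_add]; exact Submodule.add_mem _ hx hy) (fun c x _ hx => by
      rw [smul_comm]; exact Submodule.smul_mem _ _ hx) hu
    intro b hb
    have hmon : monomial (j : ℕ) a ∈ reesAlgebra I := reesAlgebra.monomial_mem.2 ha
    have h := hΨV b hb _ (mk_monomial_mem_span_pow (E := (E : Set (reesAlgebra I)))
      (by simp [E]) hs (fun g hg h => by
        refine Finset.mem_coe.2 (Finset.mem_insert_of_mem (Finset.mem_image.2
          ⟨⟨g, hg⟩, Finset.mem_attach _ _, rfl⟩))) j.2.le ha hmon)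
    rw [Submodule.mem_comap]
    convert h using 1
    funext i
    rw [hΨ]
    change Pi.single j _ i = _
    rw [coeff_monomial]
    by_cases hij : j = i
    · subst hij
      rw [Pi.single_eq_same, if_pos rfl]
      rfl
    · rw [Pi.single_eq_of_ne (Ne.symm hij), if_neg (fun h => hij (Fin.ext h)), zero_smul]
      rfl
  have hlen : ∑ j ∈ Finset.range m, relLength (I ^ j • U) (maximalIdeal R • I ^ j • U) ≤
      Module.length R (Submodule.span R (V : Set (∀ j : Fin m,
        G ⧸ (maximalIdeal R • I ^ (j : ℕ) • U)))) := by
    rw [Finset.sum_range]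
    simp only [relLength]
    rw [← Module.length_pi_of_fintype]
    refine Module.length_le_of_injective ((LinearMap.pi fun j =>
      (Submodule.subtype _) ∘ₗ LinearMap.proj j).codRestrict _ fun y => ?_) ?_
    · rw [← Finset.univ_sum_single (LinearMap.pi _ y)]
      exact Submodule.sum_mem _ fun j _ => hsingle j _ (y j).2
    · intro y z hyz
      funext j
      exact Subtype.ext (congrFun (congrArg Subtype.val hyz) j)
  refine hlen.trans ((length_span_le_card (maximalIdeal R) V ?_).trans ?_)
  · intro r hr x hx
    obtain ⟨⟨b, τ⟩, hbτ, rfl⟩ := Finset.mem_image.1 hx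
    funext j
    have hb : b ∈ U := Submodule.subset_span (Finset.mem_product.1 hbτ).1
    change r • Ψ b τ j = 0
    rw [hΨ, ← Submodule.Quotient.mk_smul]
    exact (Submodule.Quotient.mk_eq_zero _).2 (by
      rw [smul_smul r ((τ : R[X]).coeff j) b]
      exact hmem b hb j _ (Ideal.mul_mem_mul hr (τ.2 j)))
  · refine Nat.cast_le.2 (Finset.card_image_le.trans ?_)
    rw [Finset.card_product, mul_assoc]
    exact Nat.mul_le_mul_left _ hT

end Growth

end FiberCone

/-! ### Kernels over `M / I ^ n M` and Artin–Rees. -/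

section Kernel

open scoped TensorProduct

open IsLocalRing

variable {R : Type u} [CommRing R]

theorem ker_lTensor_mkQ_smul_top (K M : Type*) [AddCommGroup K] [Module R K] [AddCommGroup M]
    [Module R M] (I : Ideal R) :
    LinearMap.ker ((I • ⊤ : Submodule R M).mkQ.lTensor K) = I • ⊤ := by
  apply le_antisymm
  · rw [(lTensor_exact K (LinearMap.exact_subtype_mkQ (I • ⊤ : Submodule R M))
      (Submodule.mkQ_surjective _)).linearMap_ker_eq]
    rintro _ ⟨x, rfl⟩
    induction x using TensorProduct.induction_on with
    | zero => simp
    | add x y hx hy => rw [map_add]; exact Submodule.add_mem _ hx hy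
    | tmul a m =>
      rw [LinearMap.lTensor_tmul, Submodule.subtype_apply]
      refine Submodule.smul_induction_on (p := fun m => a ⊗ₜ[R] m ∈ I • ⊤) m.2
        (fun r hr n _ => ?_) (fun x y hx hy => ?_)
      · rw [TensorProduct.tmul_smul]
        exact Submodule.smul_mem_smul hr Submodule.mem_top
      · rw [TensorProduct.tmul_add]; exact Submodule.add_mem _ hx hy
  · rw [Submodule.smul_le]
    intro r hr x _
    rw [LinearMap.mem_ker]
    clear * - hr
    induction x using TensorProduct.induction_on with
    | zero => simp
    | add x y hx hy => rw [smul_add, map_add, hx, hy, add_zero]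
    | tmul a m =>
      rw [← TensorProduct.tmul_smul, LinearMap.lTensor_tmul, Submodule.mkQ_apply,
        (Submodule.Quotient.mk_eq_zero _).2 (Submodule.smul_mem_smul hr Submodule.mem_top),
        TensorProduct.tmul_zero]

/-- The length of the kernel of `X / I X → G / I G` in terms of relative lengths in `G`. -/
theorem length_ker_rTensor_powQuotient_le {F : Type u} [AddCommGroup F]
    [Module R F] (K : Submodule R F) (M : Type u) [AddCommGroup M] [Module R M] (I : Ideal R) :
    Module.length R (LinearMap.ker (K.subtype.rTensor (M ⧸ (I • ⊤ : Submodule R M)))) ≤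
      relLength (LinearMap.range (K.subtype.rTensor M) ⊓ I • ⊤)
        (I • LinearMap.range (K.subtype.rTensor M)) +
      Module.length R (LinearMap.ker (K.subtype.rTensor M)) := by
  set φ := K.subtype.rTensor M
  set q := (I • ⊤ : Submodule R M).mkQ
  have hsq : ∀ x, K.subtype.rTensor (M ⧸ (I • ⊤ : Submodule R M)) (q.lTensor K x) =
      q.lTensor F (φ x) := fun x => by
    rw [← LinearMap.comp_apply, ← LinearMap.comp_apply, LinearMap.rTensor_comp_lTensor,
      LinearMap.lTensor_comp_rTensor]
  have hqs : Function.Surjective (q.lTensor K) :=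
    LinearMap.lTensor_surjective K (Submodule.mkQ_surjective _)
  -- `W` is the preimage in `K ⊗ M` of the kernel to be measured, which is therefore `W / I(K ⊗ M)`.
  set W : Submodule R (TensorProduct R K M) := (I • ⊤ : Submodule R (TensorProduct R F M)).comap φ
    with hW
  have hmem : ∀ x, x ∈ W ↔ q.lTensor K x ∈
      LinearMap.ker (K.subtype.rTensor (M ⧸ (I • ⊤ : Submodule R M))) := fun x => by
    rw [LinearMap.mem_ker, hsq, ← LinearMap.mem_ker, ker_lTensor_mkQ_smul_top]; rfl
  have h1 : Module.length R (LinearMap.ker (K.subtype.rTensor (M ⧸ (I • ⊤ : Submodule R M)))) ≤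
      relLength W (I • ⊤) := by
    let f : (TensorProduct R K M ⧸ (I • ⊤ : Submodule R (TensorProduct R K M))) →ₗ[R]
        TensorProduct R K (M ⧸ (I • ⊤ : Submodule R M)) :=
      Submodule.liftQ _ (q.lTensor K) (ker_lTensor_mkQ_smul_top K M I).ge
    refine Module.length_le_of_surjective ((f ∘ₗ Submodule.subtype _).codRestrict _ ?_ :
      W.map (Submodule.mkQ (I • ⊤)) →ₗ[R] _) ?_
    · rintro ⟨_, ⟨x, hx, rfl⟩⟩
      exact (hmem x).1 hx
    · rintro ⟨y, hy⟩
      obtain ⟨x, rfl⟩ := hqs y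
      exact ⟨⟨_, ⟨x, (hmem x).2 hy, rfl⟩⟩, rfl⟩
  have hB : (I • ⊤ : Submodule R (TensorProduct R K M)) ≤
      (I • LinearMap.range φ).comap φ := by
    rw [← Submodule.map_le_iff_le_comap, Submodule.map_smul'', LinearMap.range_eq_map]
  refine h1.trans ((relLength_le_add_of_map φ W (I • ⊤) (LinearMap.ker φ)
    (I • LinearMap.range φ) hB ?_).trans (add_le_add ?_ (relLength_le_length _ _)))
  · intro x _ hx
    rw [LinearMap.range_eq_map, ← Submodule.map_smul''] at hx
    obtain ⟨y, hy, hxy⟩ := hx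
    refine Submodule.mem_sup.2 ⟨x - y, ?_, y, hy, sub_add_cancel _ _⟩
    rw [LinearMap.mem_ker, map_sub, hxy, sub_self]
  · refine relLength_mono_left _ ?_
    rintro _ ⟨x, hx, rfl⟩
    exact ⟨⟨x, rfl⟩, hx⟩

variable [IsLocalRing R] [IsNoetherianRing R] {I : Ideal R} {M : Type u} [AddCommGroup M]
  [Module R M] [Module.Finite R M] {d : ℕ}

/-- Filter by powers of `P`. Since `P` commutes with `I ^ j`, each layer is a fiber of some `P ^ l •
U`, again finitely generated and killed by `ann M`. -/
theorem exists_sum_relLength_pow_smul_le {G : Type u} [AddCommGroup G] [Module R G]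
    (hd : analyticSpread I M ≤ d) (k : ℕ) (U : Submodule R G)
    (hU : U.FG) (hann : ∀ r ∈ Module.annihilator R M, ∀ u ∈ U, r • u = 0) :
    ∃ C : ℕ, ∀ m : ℕ,
      ∑ j ∈ Finset.range m, relLength (I ^ j • U) (maximalIdeal R ^ k • I ^ j • U) ≤
        ((C * (m + 1) ^ d : ℕ) : ℕ∞) := by
  induction k generalizing U with
  | zero =>
    refine ⟨0, fun m => ?_⟩
    simp [Ideal.one_eq_top, relLength_self]
  | succ k ih =>
    obtain ⟨C, hC⟩ := exists_sum_relLength_smul_le hd U hU hann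
    obtain ⟨C', hC'⟩ := ih (maximalIdeal R • U)
      (Submodule.FG.smul (IsNoetherian.noetherian _) hU)
      (fun r hr u hu => hann r hr u (Submodule.smul_le_right hu))
    refine ⟨C + C', fun m => ?_⟩
    rw [add_mul, Nat.cast_add]
    refine le_trans ?_ (add_le_add (hC m) (hC' m))
    rw [← Finset.sum_add_distrib]
    refine Finset.sum_le_sum fun j _ => ?_
    have e : I ^ j • maximalIdeal R • U = maximalIdeal R • I ^ j • U := by
      rw [← Submodule.mul_smul, mul_comm, Submodule.mul_smul]
    rw [e, pow_succ, Submodule.mul_smul]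
    exact relLength_triangle _ _ _ Submodule.smul_le_right

/-- Growth of the kernels of `K ⊗ M / I ^ n M → F ⊗ M / I ^ n M`, when they are killed by a
fixed power of the maximal ideal. -/
theorem exists_sum_length_ker_rTensor_le (hd : analyticSpread I M ≤ d) {F : Type u}
    [AddCommGroup F] [Module R F] [Module.Finite R F] (K : Submodule R F) (k : ℕ)
    (hM : ∀ a ∈ maximalIdeal R ^ k, ∀ x ∈ LinearMap.ker (K.subtype.rTensor M), a • x = 0)
    (N : ℕ) (hk : ∀ n, ∀ a ∈ maximalIdeal R ^ k,
      ∀ x ∈ LinearMap.ker (K.subtype.rTensor (powQuotient I n M)), a • x = 0) :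
    ∃ n₀ C c : ℕ, N ≤ n₀ ∧ ∀ m : ℕ, ∑ j ∈ Finset.range m,
      Module.length R (LinearMap.ker (K.subtype.rTensor (powQuotient I (n₀ + j) M))) ≤
        ((C * (m + 1) ^ d + c * m : ℕ) : ℕ∞) := by
  set φ := K.subtype.rTensor M with hφ
  set L := LinearMap.range φ with hL
  obtain ⟨n₁, hn₁⟩ := Ideal.exists_pow_inf_eq_pow_smul I L
  set n₀ := n₁ + N with hn₀
  set U : Submodule R (TensorProduct R F M) := I ^ n₀ • ⊤ ⊓ L with hU
  obtain ⟨c, hc⟩ := ENat.ne_top_iff_exists.1 (length_lt_top_of_pow_smul_eq_bot (maximalIdeal R) k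
    (X := LinearMap.ker φ) (fun a ha x => Subtype.ext (hM a ha x x.2))).ne
  obtain ⟨C, hC⟩ := exists_sum_relLength_pow_smul_le hd k U (IsNoetherian.noetherian _) (by
    intro a ha u _
    rw [Module.mem_annihilator] at ha
    clear * - ha
    induction u using TensorProduct.induction_on with
    | zero => simp
    | add x y hx hy => rw [smul_add, hx, hy, add_zero]
    | tmul x y => rw [← TensorProduct.tmul_smul, ha, TensorProduct.tmul_zero])
  refine ⟨n₀, C, c, Nat.le_add_left _ _, fun m => ?_⟩
  have hsum : ((C * (m + 1) ^ d + c * m : ℕ) : ℕ∞) =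
      ((C * (m + 1) ^ d : ℕ) : ℕ∞) + ∑ j ∈ Finset.range m, (c : ℕ∞) := by
    rw [Finset.sum_const, Finset.card_range, nsmul_eq_mul]
    push_cast
    ring
  rw [hsum]
  refine le_trans ?_ (add_le_add_left (hC m) _)
  rw [← Finset.sum_add_distrib]
  refine Finset.sum_le_sum fun j _ => ?_
  refine (length_ker_rTensor_powQuotient_le K M (I ^ (n₀ + j))).trans ?_
  rw [← hφ, ← hc, ← hL]
  refine add_le_add_left ?_ _
  have hAR : L ⊓ I ^ (n₀ + j) • ⊤ = I ^ j • U := by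
    rw [inf_comm, hn₁ (n₀ + j) (by omega), hU, hn₁ n₀ (by omega), ← Submodule.mul_smul, ← pow_add]
    congr 2
    omega
  rw [hAR]
  -- It remains that `P ^ k` carries `L ∩ I ^ (n₀ + j) G` into `I ^ (n₀ + j) L`: if `φ x` lies in
  -- the former, the class of `x` is in a kernel killed by `P ^ k`, so `a • x ∈ I ^ (n₀ + j) (K ⊗
  -- M)`.
  refine relLength_anti_right _ ?_
  rw [← hAR, Submodule.smul_le]
  rintro a ha _ ⟨⟨x, rfl⟩, hx⟩
  have hsq : K.subtype.rTensor (powQuotient I (n₀ + j) M)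
      ((I ^ (n₀ + j) • ⊤ : Submodule R M).mkQ.lTensor K x) =
      (I ^ (n₀ + j) • ⊤ : Submodule R M).mkQ.lTensor _ (φ x) := by
    rw [← LinearMap.comp_apply, ← LinearMap.comp_apply, LinearMap.rTensor_comp_lTensor,
      LinearMap.lTensor_comp_rTensor]
  have h0 := hk (n₀ + j) a ha ((I ^ (n₀ + j) • ⊤ : Submodule R M).mkQ.lTensor K x) (by
    rw [LinearMap.mem_ker, hsq, ← LinearMap.mem_ker, ker_lTensor_mkQ_smul_top]
    exact hx)
  rw [← map_smul, ← LinearMap.mem_ker, ker_lTensor_mkQ_smul_top] at h0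
  rw [← map_smul, hL, LinearMap.range_eq_map, ← Submodule.map_smul'']
  exact Submodule.mem_map_of_mem h0

end Kernel

/-! ### Growth of `Tor` summed over powers of the ideal. -/

section TorGrowth

open IsLocalRing
open scoped TensorProduct

variable {R : Type u} [CommRing R]

theorem smul_tensor_eq_zero {A B : Type*} [AddCommGroup A] [Module R A] [AddCommGroup B]
    [Module R B] {a : R} (h : (∀ x : A, a • x = 0) ∨ (∀ x : B, a • x = 0)) (z : A ⊗[R] B) :
    a • z = 0 := by
  induction z using TensorProduct.induction_on with
  | zero => simp
  | add x y hx hy => rw [smul_add, hx, hy, add_zero]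
  | tmul x y =>
    rcases h with h | h
    · rw [TensorProduct.smul_tmul', h, TensorProduct.zero_tmul]
    · rw [← TensorProduct.tmul_smul, h, TensorProduct.tmul_zero]

theorem smul_eq_zero_of_equiv {X Y : Type*} [AddCommMonoid X] [Module R X] [AddCommMonoid Y]
    [Module R Y] (e : X ≃ₗ[R] Y) {a : R} (h : ∀ y : Y, a • y = 0) (x : X) : a • x = 0 := by
  apply e.injective
  rw [map_smul, h, map_zero]

theorem annihilator_le_annihilator_powQuotient (I : Ideal R) (n : ℕ) (M : Type u) [AddCommGroup M]
    [Module R M] : Module.annihilator R M ≤ Module.annihilator R (powQuotient I n M) :=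
  LinearMap.annihilator_le_of_surjective (Submodule.mkQ _) (Submodule.mkQ_surjective _)

variable [IsNoetherianRing R]

/-- Each annihilator is visible in one of the two descriptions: `ann A` kills `K ⊗ A` for a syzygy
`K` of `B`, and `ann B` kills `K' ⊗ B` for a syzygy `K'` of `A`. -/
theorem smul_torModule_eq_zero (i : ℕ) {A B : Type u} [AddCommGroup A] [Module R A]
    [Module.Finite R A] [AddCommGroup B] [Module R B] [Module.Finite R B] {a : R}
    (ha : a ∈ Module.annihilator R A ⊔ Module.annihilator R B) (x : torModule R i A B) :
    a • x = 0 := by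
  obtain ⟨b, hb, c, hc, rfl⟩ := Submodule.mem_sup.1 ha
  rw [Module.mem_annihilator] at hb hc
  cases i with
  | zero =>
    obtain ⟨e⟩ := nonempty_torModule_zero_equiv (R := R) A B
    rw [add_smul, smul_eq_zero_of_equiv e (smul_tensor_eq_zero (Or.inl hb)),
      smul_eq_zero_of_equiv e (smul_tensor_eq_zero (Or.inr hc)), add_zero]
  | succ i =>
    obtain ⟨F, K, -, h⟩ := exists_torModule_equiv_ker_right (R := R) i B
    obtain ⟨F', K', -, h'⟩ := exists_torModule_equiv_ker_left (R := R) i A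
    obtain ⟨e⟩ := h A
    obtain ⟨e'⟩ := h' B
    rw [add_smul, smul_eq_zero_of_equiv e (fun y => Subtype.ext
        (smul_tensor_eq_zero (Or.inr hb) y.1)),
      smul_eq_zero_of_equiv e' (fun y => Subtype.ext (smul_tensor_eq_zero (Or.inr hc) y.1)),
      add_zero]

variable [IsLocalRing R] {I : Ideal R} {M : Type u} [AddCommGroup M]
  [Module R M] [Module.Finite R M] {d : ℕ}

/-- Growth of a functorial family of modules that is computed by a fixed syzygy module `K`. -/
theorem exists_sum_length_le_of_equiv_ker (hd : analyticSpread I M ≤ d) (hd1 : 1 ≤ d)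
    {F : Type u} [AddCommGroup F] [Module R F] [Module.Finite R F] (K : Submodule R F) (k N : ℕ)
    (T : ∀ (A : Type u) [AddCommGroup A] [Module R A], ModuleCat.{u} R)
    (hT : ∀ (A : Type u) [AddCommGroup A] [Module R A],
      Nonempty (T A ≃ₗ[R] LinearMap.ker (K.subtype.rTensor A)))
    (hM : ∀ a ∈ maximalIdeal R ^ k, ∀ x : T M, a • x = 0)
    (hk : ∀ n, ∀ a ∈ maximalIdeal R ^ k, ∀ x : T (powQuotient I n M), a • x = 0) :
    ∃ n₀ C : ℕ, N ≤ n₀ ∧ ∀ m : ℕ, ∑ j ∈ Finset.range m,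
      Module.length R (T (powQuotient I (n₀ + j) M)) ≤ ((C * (m + 1) ^ d : ℕ) : ℕ∞) := by
  have key : ∀ (A : Type u) [AddCommGroup A] [Module R A] (a : R), (∀ x : T A, a • x = 0) →
      ∀ x ∈ LinearMap.ker (K.subtype.rTensor A), a • x = 0 := by
    intro A _ _ a h x hx
    obtain ⟨e⟩ := hT A
    exact congrArg Subtype.val (smul_eq_zero_of_equiv e.symm h ⟨x, hx⟩)
  obtain ⟨n₀, C, c, hN, h⟩ := exists_sum_length_ker_rTensor_le hd K k
    (fun a ha => key M a (hM a ha)) N (fun n a ha => key _ a (hk n a ha))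
  refine ⟨n₀, C + c, hN, fun m => ?_⟩
  calc ∑ j ∈ Finset.range m, Module.length R (T (powQuotient I (n₀ + j) M))
      = ∑ j ∈ Finset.range m,
          Module.length R (LinearMap.ker (K.subtype.rTensor (powQuotient I (n₀ + j) M))) := by
        refine Finset.sum_congr rfl fun j _ => ?_
        obtain ⟨e⟩ := hT (powQuotient I (n₀ + j) M)
        exact e.length_eq
    _ ≤ _ := h m
    _ ≤ _ := by
        refine Nat.cast_le.2 ?_
        rw [add_mul]
        refine Nat.add_le_add_left (Nat.mul_le_mul_left _ ?_) _
        -- The linear term is absorbed because `d ≥ 1`; this accounts for the maximum with `1` in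
        -- the bound.
        exact (Nat.le_succ m).trans (Nat.le_self_pow (by omega) _)

/-- This serves `i = 0`, where all modules are quotients of one tensor product of finite length. -/
theorem exists_sum_length_le_of_surjective (hd1 : 1 ≤ d) (k N : ℕ)
    (X : ModuleCat.{u} R) [Module.Finite R X] (hX : ∀ a ∈ maximalIdeal R ^ k, ∀ x : X, a • x = 0)
    (T : ℕ → ModuleCat.{u} R) (hT : ∀ n, ∃ f : X →ₗ[R] T n, Function.Surjective f) :
    ∃ n₀ C : ℕ, N ≤ n₀ ∧ ∀ m : ℕ, ∑ j ∈ Finset.range m,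
      Module.length R (T (n₀ + j)) ≤ ((C * (m + 1) ^ d : ℕ) : ℕ∞) := by
  obtain ⟨c, hc⟩ := ENat.ne_top_iff_exists.1
    (length_lt_top_of_pow_smul_eq_bot (maximalIdeal R) k hX).ne
  refine ⟨N, c, le_rfl, fun m => ?_⟩
  calc ∑ j ∈ Finset.range m, Module.length R (T (N + j))
      ≤ ∑ j ∈ Finset.range m, (c : ℕ∞) := by
        refine Finset.sum_le_sum fun j _ => ?_
        obtain ⟨f, hf⟩ := hT (N + j)
        rw [hc]
        exact Module.length_le_of_surjective f hf
    _ = ((m * c : ℕ) : ℕ∞) := by simp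
    _ ≤ _ := by
        refine Nat.cast_le.2 ?_
        rw [mul_comm]
        exact Nat.mul_le_mul_left _ ((Nat.le_succ m).trans (Nat.le_self_pow (by omega) _))

variable {B : Type u} [AddCommGroup B] [Module R B] [Module.Finite R B] {k : ℕ}

/-- Growth of `Tor_i(M / I ^ n M, B)`, summed over `n`, when `M ⊗ B` has finite length. -/
theorem exists_sum_length_torModule_left_le (hd : analyticSpread I M ≤ d) (hd1 : 1 ≤ d)
    (hk : maximalIdeal R ^ k ≤ Module.annihilator R M ⊔ Module.annihilator R B) (i N : ℕ) :
    ∃ n₀ C : ℕ, N ≤ n₀ ∧ ∀ m : ℕ, ∑ j ∈ Finset.range m,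
      Module.length R (torModule R i (powQuotient I (n₀ + j) M) B) ≤
        ((C * (m + 1) ^ d : ℕ) : ℕ∞) := by
  have hk' : ∀ n, maximalIdeal R ^ k ≤
      Module.annihilator R (powQuotient I n M) ⊔ Module.annihilator R B := fun n =>
    hk.trans (sup_le_sup_right (annihilator_le_annihilator_powQuotient I n M) _)
  cases i with
  | zero =>
    obtain ⟨e⟩ := nonempty_torModule_zero_equiv (R := R) M B
    have : Module.Finite R (torModule R 0 M B) := Module.Finite.equiv e.symm
    refine exists_sum_length_le_of_surjective hd1 k N (torModule R 0 M B)
      (fun a ha => smul_torModule_eq_zero 0 (hk ha))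
      (fun n => torModule R 0 (powQuotient I n M) B) fun n => ?_
    obtain ⟨e'⟩ := nonempty_torModule_zero_equiv (R := R) (powQuotient I n M) B
    exact ⟨e'.symm.toLinearMap ∘ₗ (Submodule.mkQ _).rTensor B ∘ₗ e.toLinearMap,
      e'.symm.surjective.comp ((LinearMap.rTensor_surjective B (Submodule.mkQ_surjective _)).comp
        e.surjective)⟩
  | succ i =>
    obtain ⟨F, K, hF, h⟩ := exists_torModule_equiv_ker_right (R := R) i B
    exact exists_sum_length_le_of_equiv_ker hd hd1 K k N (fun A _ _ => torModule R (i + 1) A B) h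
      (fun a ha => smul_torModule_eq_zero _ (hk ha))
      (fun n a ha => smul_torModule_eq_zero _ (hk' n ha))

/-- Growth of `Tor_i(B, M / I ^ n M)`, summed over `n`, when `B ⊗ M` has finite length. -/
theorem exists_sum_length_torModule_right_le (hd : analyticSpread I M ≤ d) (hd1 : 1 ≤ d)
    (hk : maximalIdeal R ^ k ≤ Module.annihilator R B ⊔ Module.annihilator R M) (i N : ℕ) :
    ∃ n₀ C : ℕ, N ≤ n₀ ∧ ∀ m : ℕ, ∑ j ∈ Finset.range m,
      Module.length R (torModule R i B (powQuotient I (n₀ + j) M)) ≤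
        ((C * (m + 1) ^ d : ℕ) : ℕ∞) := by
  have hk' : ∀ n, maximalIdeal R ^ k ≤
      Module.annihilator R B ⊔ Module.annihilator R (powQuotient I n M) := fun n =>
    hk.trans (sup_le_sup_left (annihilator_le_annihilator_powQuotient I n M) _)
  cases i with
  | zero =>
    obtain ⟨e⟩ := nonempty_torModule_zero_equiv (R := R) B M
    have : Module.Finite R (torModule R 0 B M) := Module.Finite.equiv e.symm
    refine exists_sum_length_le_of_surjective hd1 k N (torModule R 0 B M)
      (fun a ha => smul_torModule_eq_zero 0 (hk ha))
      (fun n => torModule R 0 B (powQuotient I n M)) fun n => ?_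
    obtain ⟨e'⟩ := nonempty_torModule_zero_equiv (R := R) B (powQuotient I n M)
    exact ⟨e'.symm.toLinearMap ∘ₗ (Submodule.mkQ _).lTensor B ∘ₗ e.toLinearMap,
      e'.symm.surjective.comp ((LinearMap.lTensor_surjective B (Submodule.mkQ_surjective _)).comp
        e.surjective)⟩
  | succ i =>
    obtain ⟨F, K, hF, h⟩ := exists_torModule_equiv_ker_left (R := R) i B
    exact exists_sum_length_le_of_equiv_ker hd hd1 K k N (fun A _ _ => torModule R (i + 1) B A) h
      (fun a ha => smul_torModule_eq_zero _ (hk ha))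
      (fun n a ha => smul_torModule_eq_zero _ (hk' n ha))

end TorGrowth

/-! ### Degrees of polynomials from their partial sums. -/

section PolynomialGrowth

open Polynomial Filter

/-- A polynomial that is nonnegative on `ℕ` and whose partial sums grow at most like `m ^ e` has
degree less than `e`. -/
theorem natDegree_lt_of_sum_le {q : ℚ[X]} {e C : ℕ} (he : 1 ≤ e)
    (h0 : ∀ j : ℕ, 0 ≤ q.eval (j : ℚ))
    (h : ∀ m : ℕ, ∑ j ∈ Finset.range m, q.eval (j : ℚ) ≤ C * (m + 1) ^ e) : q.natDegree < e := by
  by_contra! hq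
  have hq0 : 0 < q.degree := natDegree_pos_iff_degree_pos.1 (by omega)
  have hlc : 0 ≤ q.leadingCoeff := by
    by_contra! hlc
    have := (q.tendsto_atBot_of_leadingCoeff_nonpos hq0 hlc.le).comp
      (tendsto_natCast_atTop_atTop (R := ℚ))
    obtain ⟨j, hj⟩ := (this.eventually_lt_atBot 0).exists
    exact absurd hj (not_lt.2 (h0 j))
  -- As `(M + 1) ^ e ≤ 2 ^ e * M ^ e`, this `A` makes `A * M ^ e` exceed the allowed bound by at
  -- least `M ^ e`. `D` is the forward difference of `A * X ^ e`, of degree below `e`, so `q`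
  -- eventually dominates it.
  let A : ℚ := C * 2 ^ e + 1
  let D : ℚ[X] := Polynomial.C A * ((X + 1) ^ e - X ^ e)
  have hD : D.degree < q.degree := by
    have hA : A ≠ 0 := by positivity
    rw [degree_C_mul hA]
    have hm : ((X + 1 : ℚ[X]) ^ e).Monic := (monic_X_add_C (1 : ℚ)).pow e
    have hdeg : ((X + 1 : ℚ[X]) ^ e).degree = e := by
      rw [degree_pow, ← C_1, degree_X_add_C]; simp
    refine (degree_sub_lt_left (by rw [hdeg, degree_X_pow]) hm.ne_zero
      (by rw [hm.leadingCoeff, (monic_X_pow e).leadingCoeff])).trans_le ?_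
    rw [hdeg, degree_eq_natDegree (ne_zero_of_degree_gt hq0)]
    exact_mod_cast hq
  have hdiff : (q - D).degree = q.degree := degree_sub_eq_left_of_degree_lt hD
  have hlim := ((q - D).tendsto_atTop_of_leadingCoeff_nonneg (by rwa [hdiff])
    (by rwa [leadingCoeff_sub_of_degree_lt hD])).comp (tendsto_natCast_atTop_atTop (R := ℚ))
  obtain ⟨N, hN⟩ := eventually_atTop.1 (hlim.eventually_ge_atTop 0)
  have hsum : ∀ m : ℕ, A * ((N + m : ℕ) ^ e - N ^ e) ≤ ∑ j ∈ Finset.range (N + m), q.eval (j : ℚ) := by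
    intro m
    induction m with
    | zero => simpa using Finset.sum_nonneg fun j _ => h0 j
    | succ m ih =>
      rw [← add_assoc, Finset.sum_range_succ]
      have h1 := hN (N + m) (Nat.le_add_right _ _)
      simp only [Function.comp_apply, eval_sub, D, eval_mul, eval_C, eval_pow, eval_add, eval_X,
        eval_one] at h1
      push_cast at h1 ih ⊢
      linarith
  -- Large enough that `A * N ^ e < M ≤ M ^ e`, whereas the two bounds on the sum force `M ^ e ≤ A *
  -- N ^ e`.
  let M : ℕ := N + (C * 2 ^ e + 1) * N ^ e + 1
  have h1 := (hsum (M - N)).trans (h (N + (M - N)))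
  rw [Nat.add_sub_cancel' (by omega)] at h1
  have hM1 : (1 : ℚ) ≤ M := by
    have : 1 ≤ M := by omega
    exact_mod_cast this
  have h2 : ((M : ℚ) + 1) ^ e ≤ 2 ^ e * (M : ℚ) ^ e := by
    rw [← mul_pow]
    exact pow_le_pow_left₀ (by positivity) (by linarith) _
  have h3 : (M : ℚ) ≤ (M : ℚ) ^ e := le_self_pow₀ hM1 (by omega)
  have h4 : A * (N : ℚ) ^ e + 1 ≤ M := by
    simp only [M, A]
    push_cast
    have : (0 : ℚ) ≤ N := Nat.cast_nonneg N
    linarith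
  have h5 := mul_le_mul_of_nonneg_left h2 (Nat.cast_nonneg (α := ℚ) C)
  simp only [A] at h1 h4
  nlinarith

/-- The degree of a bivariate polynomial in its first variable can be read off from its
specializations at large integers. -/
theorem degreeOf_zero_lt_of_sum_le {p : MvPolynomial (Fin 2) ℚ} {e k : ℕ} (he : 1 ≤ e)
    (h : ∀ m, k ≤ m → ∃ n₀ C : ℕ, (∀ j : ℕ, 0 ≤ MvPolynomial.eval ![((n₀ + j : ℕ) : ℚ), (m : ℚ)] p) ∧
      ∀ l : ℕ, ∑ j ∈ Finset.range l, MvPolynomial.eval ![((n₀ + j : ℕ) : ℚ), (m : ℚ)] p ≤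
        C * (l + 1) ^ e) : p.degreeOf 0 < e := by
  set P := MvPolynomial.finSuccEquiv ℚ 1 p with hP
  rw [← MvPolynomial.natDegree_finSuccEquiv, ← hP]
  by_contra! hdeg
  -- The leading coefficient is a polynomial in the second variable vanishing at every integer `m ≥
  -- k`; `n₀` and `C` may vary with `m`.
  have hlc : P.leadingCoeff = 0 := by
    refine MvPolynomial.funext_set (fun _ => (Nat.cast : ℕ → ℚ) '' Set.Ici k)
      (fun _ => (Set.Ici_infinite k).image Nat.cast_injective.injOn) fun x hx => ?_
    obtain ⟨m, hm, hmx⟩ := hx 0 trivial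
    obtain ⟨n₀, C, h0, hs⟩ := h m hm
    have hev : ∀ y : ℚ, MvPolynomial.eval ![y, (m : ℚ)] p =
        (P.map (MvPolynomial.eval x)).eval y := fun y => by
      rw [← MvPolynomial.eval_eq_eval_mv_eval']
      congr 1
      congr 1
      funext i
      fin_cases i
      · rfl
      · exact hmx
    have hcomp : ∀ j : ℕ, MvPolynomial.eval ![((n₀ + j : ℕ) : ℚ), (m : ℚ)] p =
        ((P.map (MvPolynomial.eval x)).comp (X + Polynomial.C (n₀ : ℚ))).eval (j : ℚ) := fun j => by
      rw [hev, eval_comp]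
      simp [add_comm]
    simp only [hcomp] at h0 hs
    have := natDegree_lt_of_sum_le he h0 hs
    rw [natDegree_comp, natDegree_X_add_C, mul_one] at this
    rw [map_zero, leadingCoeff, ← coeff_map]
    exact coeff_eq_zero_of_natDegree_lt (this.trans_le hdeg)
  rw [leadingCoeff_eq_zero] at hlc
  rw [hlc, natDegree_zero] at hdeg
  omega

theorem totalDegree_le_degreeOf_add (p : MvPolynomial (Fin 2) ℚ) :
    p.totalDegree ≤ p.degreeOf 0 + p.degreeOf 1 := by
  refine Finset.sup_le fun α hα => ?_
  rw [Finsupp.sum_fintype _ _ (fun _ => rfl), Fin.sum_univ_two]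
  exact add_le_add (MvPolynomial.monomial_le_degreeOf 0 hα)
    (MvPolynomial.monomial_le_degreeOf 1 hα)

end PolynomialGrowth

/-! ### The degree bound. -/

section Main

open IsLocalRing

/-- `J ^ m` kills `N / J ^ m N`, so the radical of the right side contains `J + ann M + ann N`,
hence `P`. -/
theorem exists_maximalIdeal_pow_le {R : Type u} [CommRing R] [IsLocalRing R] [IsNoetherianRing R]
    {J : Ideal R} {M N : Type u} [AddCommGroup M] [Module R M] [AddCommGroup N] [Module R N]
    (hJ : IsPrimaryTo (J ⊔ Module.annihilator R M ⊔ Module.annihilator R N) (maximalIdeal R))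
    (m : ℕ) : ∃ k, maximalIdeal R ^ k ≤
      Module.annihilator R M ⊔ Module.annihilator R (powQuotient J m N) := by
  refine Ideal.exists_pow_le_of_le_radical_of_fg ?_ (IsNoetherian.noetherian _)
  rw [← hJ.2]
  refine Ideal.radical_le_radical_iff.2 (sup_le (sup_le ?_ ?_) ?_)
  · intro a ha
    refine ⟨m, Submodule.mem_sup_right (Module.mem_annihilator.2 fun x => ?_)⟩
    obtain ⟨y, rfl⟩ := Submodule.mkQ_surjective _ x
    rw [← map_smul]
    exact (Submodule.Quotient.mk_eq_zero _).2
      (Submodule.smul_mem_smul (Ideal.pow_mem_pow ha m) Submodule.mem_top)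
  · exact le_sup_left.trans Ideal.le_radical
  · exact (annihilator_le_annihilator_powQuotient J m N).trans
      (le_sup_right.trans Ideal.le_radical)

/-- Bounds on the lengths of the modules `T n` carry over to the numbers `f n`. -/
theorem sum_le_of_length_le {R : Type u} [CommRing R] {T : ℕ → ModuleCat.{u} R} {f : ℕ → ℚ}
    {n₀ C d : ℕ} (hf : ∀ n, n₀ ≤ n → ∃ l : ℕ, Module.length R (T n) = (l : ℕ∞) ∧ (l : ℚ) = f n)
    (h : ∀ m : ℕ, ∑ j ∈ Finset.range m, Module.length R (T (n₀ + j)) ≤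
      ((C * (m + 1) ^ d : ℕ) : ℕ∞)) :
    (∀ j, 0 ≤ f (n₀ + j)) ∧
      ∀ m : ℕ, ∑ j ∈ Finset.range m, f (n₀ + j) ≤ C * (m + 1) ^ d := by
  choose l hl hlf using fun j => hf (n₀ + j) (Nat.le_add_right _ _)
  refine ⟨fun j => by rw [← hlf]; positivity, fun m => ?_⟩
  have h' := h m
  simp only [hl] at h'
  simp only [← hlf]
  exact_mod_cast h'

/-- The `2` stands on the left to avoid subtraction in `WithBot ℕ∞`. For `p = 0`, where
`totalDegree` is `0`, the bound holds as both maxima are at least `1`. -/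
theorem proposition10 {R : Type u} [CommRing R] [IsLocalRing R] [IsNoetherianRing R]
    (I J : Ideal R)
    (M N : Type u) [AddCommGroup M] [Module R M] [Module.Finite R M]
    [AddCommGroup N] [Module R N] [Module.Finite R N]
    (i : ℕ)
    (hI : IsPrimaryTo (I ⊔ Module.annihilator R M ⊔ Module.annihilator R N)
      (IsLocalRing.maximalIdeal R))
    (hJ : IsPrimaryTo (J ⊔ Module.annihilator R M ⊔ Module.annihilator R N)
      (IsLocalRing.maximalIdeal R))
    (p : MvPolynomial (Fin 2) ℚ)
    (hp : LengthEventuallyEq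
      (fun n m => torModule R i (powQuotient I n M) (powQuotient J m N)) p) :
    (p.totalDegree : WithBot ℕ∞) + 2 ≤ max (analyticSpread I M) 1 + max (analyticSpread J N) 1 := by
  obtain ⟨k, hp⟩ := hp
  -- An infinite spread makes the bound trivial; the value `⊥` of a zero fiber module is covered by
  -- `d = 1`.
  have hcase : ∀ x : WithBot ℕ∞, max x 1 = ⊤ ∨ ∃ d : ℕ, max x 1 = d ∧ x ≤ d ∧ 1 ≤ d := by
    intro x
    induction x using WithBot.recBotCoe with
    | bot => exact Or.inr ⟨1, by simp, bot_le, le_rfl⟩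
    | coe x =>
      induction x using ENat.recTopCoe with
      | top => exact Or.inl (max_eq_left le_top)
      | coe n =>
        rcases le_total n 1 with h | h
        · exact Or.inr ⟨1, max_eq_right (by exact_mod_cast h), by exact_mod_cast h, le_rfl⟩
        · exact Or.inr ⟨n, max_eq_left (by exact_mod_cast h), le_rfl, h⟩
  have htop : ∀ x : WithBot ℕ∞, (⊤ : WithBot ℕ∞) + max x 1 = ⊤ := fun x => by
    obtain ⟨y, hy⟩ := WithBot.ne_bot_iff_exists.1
      (lt_of_lt_of_le (WithBot.bot_lt_coe (1 : ℕ∞)) (le_max_right x 1)).ne'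
    rw [← hy]
    exact congrArg WithBot.some (top_add y)
  rcases hcase (analyticSpread I M) with h1 | ⟨d₁, hd₁, hle₁, hone₁⟩
  · rw [h1, htop]; exact le_top
  rcases hcase (analyticSpread J N) with h2 | ⟨d₂, hd₂, hle₂, hone₂⟩
  · rw [h2, add_comm (max _ _), htop]; exact le_top
  have b₁ : p.degreeOf 0 < d₁ := by
    refine degreeOf_zero_lt_of_sum_le (k := k) hone₁ fun m hm => ?_
    obtain ⟨s, hs⟩ := exists_maximalIdeal_pow_le hJ m
    obtain ⟨n₀, C, hn₀, hC⟩ := exists_sum_length_torModule_left_le hle₁ hone₁ hs i k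
    exact ⟨n₀, C, sum_le_of_length_le (f := fun n => MvPolynomial.eval ![(n : ℚ), (m : ℚ)] p)
      (fun n hn => hp n m (hn₀.trans hn) hm) hC⟩
  have b₂ : p.degreeOf 1 < d₂ := by
    have hswap : ∀ x y : ℚ, MvPolynomial.eval ![x, y] (MvPolynomial.rename (Equiv.swap 0 1) p) =
        MvPolynomial.eval ![y, x] p := fun x y => by
      rw [MvPolynomial.eval_rename]
      congr 1
      congr 1
      funext i
      fin_cases i <;> rfl
    have hdeg := MvPolynomial.degreeOf_rename_of_injective (p := p)
      (Equiv.swap (0 : Fin 2) 1).injective 1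
    rw [Equiv.swap_apply_right] at hdeg
    rw [← hdeg]
    refine degreeOf_zero_lt_of_sum_le (k := k) hone₂ fun n hn => ?_
    obtain ⟨s, hs⟩ := exists_maximalIdeal_pow_le (M := N) (N := M) (J := I)
      (by rwa [sup_right_comm]) n
    rw [sup_comm] at hs
    obtain ⟨m₀, C, hm₀, hC⟩ := exists_sum_length_torModule_right_le hle₂ hone₂ hs i k
    refine ⟨m₀, C, ?_⟩
    simp only [hswap]
    exact sum_le_of_length_le (f := fun m => MvPolynomial.eval ![(n : ℚ), (m : ℚ)] p)
      (fun m hm => hp n m hn (hm₀.trans hm)) hC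
  have := totalDegree_le_degreeOf_add p
  rw [hd₁, hd₂]
  have h : p.totalDegree + 2 ≤ d₁ + d₂ := by omega
  exact_mod_cast h

end Main
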